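/- Let $N\ge 1$, let $\Omega\subset\mathbb{R}^N$ be a bounded domain (non-empty, open, connected), and let $1<p<\infty$. Let $\mathbf a:\Omega\times\mathbb{R}^N\to\mathbb{R}^N$ be a Carathéodory function ($\mathbf a(\cdot,\xi)$ is measurable for every $\xi$, and $\mathbf a(x,\cdot)$ is continuous for a.e. $x$) such that, for some $\Phi:\Omega\times\mathbb{R}^N\to\mathbb{R}$ and constants $0<\alpha\le\beta$, the following hold for a.e. $x\in\Omega$: - (H1) $\Phi(x,0)=0$ and $\mathbf a(x,\xi)=\nabla_\xi\Phi(x,\xi)$ for all $\xi\in\mathbb{R}^N$; - (H2) $\frac{\alpha}{p}|\xi|^p\le\Phi(x,\xi)\le\frac{\beta}{p}|\xi|^p$ for all $\xi\in\mathbb{R}^N$; - (H3) $\xi\mapsto\Phi(x,\xi)$ is strictly convex on $\mathbb{R}^N$. Let $\ell\in\{0,\infty\}$, let $f:\mathbb{R}\to\mathbb{R}$ be continuous with $f(0)\ge 0$, and put $F(s)=\int_0^s f(t)\,dt$ for $s\ge 0$. Suppose that there is a sequence of positive reals $\alpha_n\to\ell$ with $f(\alpha_n)=0$ for all $n$, and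 that there are a sequence of positive reals $\gamma_n\to\ell$, an $L^+\in(0,\infty]$ and a constant $M\ge 0$ such that $$\frac{F(\gamma_n)}{\gamma_n^p}\to L^+\qquad\text{and}\qquad -\min_{t\in[0,\gamma_n]}F(t)\le M\,F(\gamma_n)\quad\text{for all }n.$$ Then there exists $\overline\lambda\in[0,\infty)$, which can be taken to be $\overline\lambda=0$ if $L^+=\infty$, such that for every $\lambda>\overline\lambda$ the problem $$-\operatorname{div}(\mathbf a(x,\nabla u))=\lambda f(u)\ \text{ in }\Omega,\qquad u=0\ \text{ on }\partial\Omega,$$ has a sequence $\{u_n\}$ of bounded weak solutions with $u_n\ge 0$ a.e. in $\Omega$, $u_n\not\equiv 0$ for every $n$, and $\|u_n\|_{L^\infty(\Omega)}\to\ell$. Here a bounded weak solution is a function $u\in W^{1,p}_0(\Omega)\cap L^\infty(\Omega)$ with $\int_\Omega \mathbf a(x,\nabla u)\cdot\nabla v\,dx=\lambda\int_\Omega f(u)\,v\,dx$ for all $v\in W^{1,p}_0(\Omega)$, where $W^{1,p}_0(\Omega)$ is the closure of $C_c^\infty(\Omega)$ in $W^{1,p}(\Omega)$. -/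

import Mathlib

open MeasureTheory Filter Topology
open scoped ENNReal ContDiff

namespace DirichletOsc

/-- The space `ℝᴺ` with its Euclidean norm. -/
abbrev Rn (N : ℕ) : Type := EuclideanSpace ℝ (Fin N)

/-- `F(s) = ∫₀ˢ f(t) dt`. -/
noncomputable def primitive (f : ℝ → ℝ) (s : ℝ) : ℝ := ∫ t in (0 : ℝ)..s, f t

section Sobolev

variable {N : ℕ}

/-- `φ ∈ C_c^∞(Ω)`. -/
structure IsTestFunction (Ω : Set (Rn N)) (φ : Rn N → ℝ) : Prop where
  smooth : ContDiff ℝ ∞ φ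
  compact_support : HasCompactSupport φ
  support_subset : tsupport φ ⊆ Ω

/-- `g` is the weak (distributional) gradient of `u` in the open set `Ω`. -/
structure HasWeakGradient (Ω : Set (Rn N)) (u : Rn N → ℝ) (g : Rn N → Rn N) : Prop where
  locInt : LocallyIntegrableOn u Ω
  locInt_grad : LocallyIntegrableOn g Ω
  integral_eq : ∀ φ : Rn N → ℝ, IsTestFunction Ω φ →
    ∫ x in Ω, u x • gradient φ x = - ∫ x in Ω, φ x • g x

/-- `u ∈ W^{1,p}(Ω)` with weak gradient `∇u = g`. -/
structure MemW1p (Ω : Set (Rn N)) (p : ℝ) (u : Rn N → ℝ) (g : Rn N → Rn N) : Prop where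
  memLp : MemLp u (ENNReal.ofReal p) (volume.restrict Ω)
  memLp_grad : MemLp g (ENNReal.ofReal p) (volume.restrict Ω)
  weakGradient : HasWeakGradient Ω u g

/-- `u ∈ W₀^{1,p}(Ω)` with weak gradient `∇u = g`: here `W₀^{1,p}(Ω)` is the closure of
`C_c^∞(Ω)` in `W^{1,p}(Ω)`. -/
structure MemW1p0 (Ω : Set (Rn N)) (p : ℝ) (u : Rn N → ℝ) (g : Rn N → Rn N) : Prop where
  memW1p : MemW1p Ω p u g
  approx : ∃ φ : ℕ → Rn N → ℝ, (∀ k, IsTestFunction Ω (φ k)) ∧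
    Tendsto (fun k => eLpNorm (fun x => u x - φ k x) (ENNReal.ofReal p) (volume.restrict Ω))
      atTop (𝓝 0) ∧
    Tendsto (fun k => eLpNorm (fun x => g x - gradient (φ k) x) (ENNReal.ofReal p)
      (volume.restrict Ω)) atTop (𝓝 0)

/-- `a` is a Carathéodory function on `Ω × ℝᴺ`: (Lebesgue) measurable in `x ∈ Ω` for every fixed
`ξ`, and continuous in `ξ` for almost every fixed `x ∈ Ω`. -/
structure IsCaratheodory (Ω : Set (Rn N)) (a : Rn N → Rn N → Rn N) : Prop where
  measurable : ∀ ξ, AEMeasurable (fun x => a x ξ) (volume.restrict Ω)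
  continuous : ∀ᵐ x ∂(volume.restrict Ω), Continuous (a x)

/-- The structure assumptions on the operator `div a(x, ∇u)`: `a` is a Carathéodory function with
* potential structure: `a(x, ξ) = ∇_ξ Φ(x, ξ)` and `Φ(x, 0) = 0`;
* `p`-growth and coercivity: `(α / p) |ξ|^p ≤ Φ(x, ξ) ≤ (β / p) |ξ|^p` with `0 < α ≤ β`;
* strict convexity of `ξ ↦ Φ(x, ξ)`;
each for almost every `x ∈ Ω`. -/
structure IsVariationalOperator (Ω : Set (Rn N)) (p : ℝ) (Φ : Rn N → Rn N → ℝ)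
    (a : Rn N → Rn N → Rn N) : Prop where
  caratheodory : IsCaratheodory Ω a
  potential : ∀ᵐ x ∂(volume.restrict Ω), Φ x 0 = 0 ∧ ∀ ξ, HasGradientAt (Φ x) (a x ξ) ξ
  growth : ∃ α β : ℝ, 0 < α ∧ α ≤ β ∧ ∀ᵐ x ∂(volume.restrict Ω), ∀ ξ,
    α / p * ‖ξ‖ ^ p ≤ Φ x ξ ∧ Φ x ξ ≤ β / p * ‖ξ‖ ^ p
  strictConvex : ∀ᵐ x ∂(volume.restrict Ω), StrictConvexOn ℝ Set.univ (Φ x)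

/-- `u` is a weak solution of `-div a(x, ∇u) = lam f(u)` in `Ω`, `u = 0` on `∂Ω`:
`u ∈ W₀^{1,p}(Ω)` and `∫_Ω a(x, ∇u) · ∇v = lam ∫_Ω f(u) v` for every `v ∈ W₀^{1,p}(Ω)`,
both integrands being integrable. -/
def IsWeakSolution (Ω : Set (Rn N)) (p : ℝ) (a : Rn N → Rn N → Rn N) (f : ℝ → ℝ) (lam : ℝ)
    (u : Rn N → ℝ) : Prop :=
  ∃ g : Rn N → Rn N, MemW1p0 Ω p u g ∧
    ∀ (v : Rn N → ℝ) (h : Rn N → Rn N), MemW1p0 Ω p v h →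
      IntegrableOn (fun x => inner ℝ (a x (g x)) (h x)) Ω ∧
      IntegrableOn (fun x => f (u x) * v x) Ω ∧
      ∫ x in Ω, inner ℝ (a x (g x)) (h x) = lam * ∫ x in Ω, f (u x) * v x

end Sobolev

end DirichletOsc

/-!
Solutions below a zero `s = α n` of `f` come from a truncated variational problem. Freezing `f`
outside `[0, s]` gives a bounded continuous nonlinearity whose primitive `G` does not decrease when
its argument is truncated at `0` and `s` (`primitive_clampFun_le`; this is where `f 0 ≥ 0` and
`f s = 0` enter), while truncation does not increase the energy `∫ Φ(x, ∇u)`. The functional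
`∫ Φ(x, ∇u) - lam ∫ G(u)` over `W₀^{1,p}` therefore has a minimiser with values in `[0, s]`
(`exists_minimiser`), and such a minimiser solves the original problem
(`IsVariationalOperator.eulerLagrange`): the truncated functional is differentiable in all
directions of `W₀^{1,p}`, and the truncated nonlinearity agrees with `f` on `[0, s]`. No comparison
principle or regularity theory is needed.

The direct method is carried out on test functions, whose infimum is the infimum over `W₀^{1,p}`
because the energy is continuous in `L^p` (`IsConvexIntegrand.tendsto_energy`). A minimising sequence
can be replaced by smooth truncations (`IsTestFunction.exists_clamp`), so it is bounded in `L^∞` and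
in `W^{1,1}` and converges almost everywhere along a subsequence (`exists_subseq_tendsto_ae`). Weak
compactness of the gradients is replaced by uniform convexity of the `L^p` norm: among the functions
close to the limit and of almost minimal energy, which form a decreasing sequence of convex sets,
those of almost minimal gradient norm have strongly convergent gradients
(`exists_tendsto_of_antitone_midpoint`).

The hypotheses on `F(γ m)` provide competitors `γ m φ`, with `φ` a cutoff function equal to `1` on a
compact set `K` so large that `κ = |K| - M |Ω \ K| > 0`. Their functional is at most
`(β / p) γ^p ∫ |∇φ|^p - lam κ F(γ)`, which for `lam` above a threshold is at most `-δ γ^p`. As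
`Φ ≥ 0`, the solution `u` below `α n ≥ γ m` satisfies `lam ∫ F(u) ≥ δ (γ m)^p`. For `ℓ = 0` this
excludes `u = 0`, and `‖u‖_∞ ≤ α n → 0`. For `ℓ = ∞` the right-hand side is unbounded in `m`, whereas
`∫ F(u)` is bounded as long as `‖u‖_∞` is, so a sequence of indices `n` with `‖u‖_∞ → ∞` exists.
-/

namespace DirichletOsc

/-! ### Convex Carathéodory integrands -/

section Caratheodory

variable {X E F : Type*} [MeasurableSpace X] {μ : Measure X}
  [TopologicalSpace E] [TopologicalSpace F] [TopologicalSpace.PseudoMetrizableSpace F]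
  [MeasurableSpace F] [BorelSpace F]

/-- The composition of a Carathéodory function with a measurable function is measurable: along
simple functions approximating `g` it is measurable on each of the countably many level sets. -/
theorem aemeasurable_caratheodory_comp {a : X → E → F}
    (hm : ∀ ξ, AEMeasurable (fun x => a x ξ) μ) (hc : ∀ᵐ x ∂μ, Continuous (a x))
    {g : X → E} (hg : AEStronglyMeasurable g μ) : AEMeasurable (fun x => a x (g x)) μ := by
  have hgm := hg.stronglyMeasurable_mk
  have hs : ∀ k, AEMeasurable (fun x => a x (hgm.approx k x)) μ := by
    intro k
    set s := hgm.approx k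
    have hU : (⋃ c : s.range, s ⁻¹' {(c : E)}) = Set.univ := by
      ext x
      simp
    rw [← Measure.restrict_univ (μ := μ), ← hU, aemeasurable_iUnion_iff]
    rintro ⟨c, _⟩
    refine (hm c).restrict.congr ?_
    filter_upwards [ae_restrict_mem (s.measurableSet_fiber c)] with x hx
    have hx' : s x = c := hx
    rw [hx']
  refine (aemeasurable_of_tendsto_metrizable_ae atTop hs
    (g := fun x => a x (hg.mk g x)) ?_).congr ?_
  · filter_upwards [hc] with x hx
    exact (hx.tendsto _).comp (hgm.tendsto_approx x)
  · filter_upwards [hg.ae_eq_mk] with x hx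
    rw [← hx]

end Caratheodory

section Gradient

variable {E : Type*} [NormedAddCommGroup E] [InnerProductSpace ℝ E]

theorem convexOn_comp_line {φ : E → ℝ} (h : ConvexOn ℝ Set.univ φ) (ξ d : E) :
    ConvexOn ℝ Set.univ (fun t : ℝ => φ (ξ + t • d)) := by
  have := h.comp_affineMap (AffineMap.lineMap ξ (ξ + d))
  simpa [Function.comp_def, AffineMap.lineMap_apply, add_comm] using this

variable [CompleteSpace E]

theorem hasDerivAt_comp_line {φ : E → ℝ} {A ξ : E} (h : HasGradientAt φ A ξ) (d : E) :
    HasDerivAt (fun t : ℝ => φ (ξ + t • d)) (inner ℝ A d) 0 := by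
  have h1 : HasDerivAt (fun t : ℝ => ξ + t • d) d 0 := by
    simpa using ((hasDerivAt_id (0 : ℝ)).smul_const d).const_add ξ
  have h2 : HasFDerivAt φ (InnerProductSpace.toDual ℝ E A) (ξ + (0 : ℝ) • d) := by
    simpa using h.hasFDerivAt
  exact h2.comp_hasDerivAt (0 : ℝ) h1

/-- A convex function lies above its tangent planes. -/
theorem inner_gradient_le_sub {φ : E → ℝ} (hφ : ConvexOn ℝ Set.univ φ) {A ξ : E}
    (h : HasGradientAt φ A ξ) (η : E) : inner ℝ A (η - ξ) ≤ φ η - φ ξ := by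
  have h1 := (convexOn_comp_line hφ ξ (η - ξ)).le_slope_of_hasDerivAt
    (Set.mem_univ 0) (Set.mem_univ 1) one_pos (hasDerivAt_comp_line h (η - ξ))
  simpa [slope_def_field] using h1

/-- The Riemann sums of `t ↦ ⟪a (t ξ), ξ⟫` on `[0, 1]` converge to `φ ξ - φ 0` when `φ` is convex
with gradient `a`: monotonicity of the gradient bounds the error by `⟪a ξ - a 0, ξ⟫ / n`. -/
theorem tendsto_riemannSum_gradient {φ : E → ℝ} {a : E → E} (hφ : ConvexOn ℝ Set.univ φ)
    (h : ∀ ξ, HasGradientAt φ (a ξ) ξ) (ξ : E) :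
    Tendsto (fun n : ℕ => ∑ i ∈ Finset.range (n + 1),
      inner ℝ (a (((i : ℝ) / (n + 1 : ℝ)) • ξ)) ξ / (n + 1 : ℝ)) atTop (𝓝 (φ ξ - φ 0)) := by
  have key : ∀ s t : ℝ, (t - s) * inner ℝ (a (s • ξ)) ξ ≤ φ (t • ξ) - φ (s • ξ) := by
    intro s t
    have := inner_gradient_le_sub hφ (h (s • ξ)) (t • ξ)
    rwa [← sub_smul, inner_smul_right] at this
  have tele : ∀ n : ℕ, ∑ i ∈ Finset.range (n + 1), (φ ((((i + 1 : ℕ) : ℝ) / (n + 1 : ℝ)) • ξ)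
      - φ (((i : ℝ) / (n + 1 : ℝ)) • ξ)) = φ ξ - φ 0 := by
    intro n
    have hn : (n + 1 : ℝ) ≠ 0 := by positivity
    rw [Finset.sum_range_sub (fun i : ℕ => φ (((i : ℝ) / (n + 1 : ℝ)) • ξ))]
    simp [div_self hn]
  have tele' : ∀ n : ℕ, ∑ i ∈ Finset.range (n + 1),
      (inner ℝ (a ((((i + 1 : ℕ) : ℝ) / (n + 1 : ℝ)) • ξ)) ξ / (n + 1 : ℝ)
        - inner ℝ (a (((i : ℝ) / (n + 1 : ℝ)) • ξ)) ξ / (n + 1 : ℝ))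
      = (inner ℝ (a ξ) ξ - inner ℝ (a 0) ξ) / (n + 1 : ℝ) := by
    intro n
    have hn : (n + 1 : ℝ) ≠ 0 := by positivity
    rw [Finset.sum_range_sub
      (fun i : ℕ => inner ℝ (a (((i : ℝ) / (n + 1 : ℝ)) • ξ)) ξ / (n + 1 : ℝ))]
    simp [div_self hn, sub_div]
  have hstep : ∀ (n i : ℕ), (((i + 1 : ℕ) : ℝ) / (n + 1 : ℝ)) - (i : ℝ) / (n + 1 : ℝ)
      = 1 / (n + 1 : ℝ) := by
    intro n i
    push_cast
    ring
  refine tendsto_of_tendsto_of_tendsto_of_le_of_le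
    (g := fun n : ℕ => (φ ξ - φ 0) - (inner ℝ (a ξ) ξ - inner ℝ (a 0) ξ) / (n + 1 : ℝ))
    (h := fun _ => φ ξ - φ 0) ?_ tendsto_const_nhds ?_ ?_
  · have := (tendsto_one_div_add_atTop_nhds_zero_nat (𝕜 := ℝ)).const_mul
      (inner ℝ (a ξ) ξ - inner ℝ (a 0) ξ)
    simpa [div_eq_mul_inv] using tendsto_const_nhds.sub this
  · intro n
    simp only
    rw [← tele' n, ← tele n, ← Finset.sum_sub_distrib]
    refine Finset.sum_le_sum fun i _ => ?_
    have h1 := key (((i + 1 : ℕ) : ℝ) / (n + 1 : ℝ)) ((i : ℝ) / (n + 1 : ℝ))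
    have h2 := hstep n i
    have h3 : (i : ℝ) / (n + 1 : ℝ) - ((i + 1 : ℕ) : ℝ) / (n + 1 : ℝ) = -(1 / (n + 1 : ℝ)) := by
      linarith
    rw [h3] at h1
    have h4 : -(1 / (n + 1 : ℝ)) * inner ℝ (a ((((i + 1 : ℕ) : ℝ) / (n + 1 : ℝ)) • ξ)) ξ
      = -(inner ℝ (a ((((i + 1 : ℕ) : ℝ) / (n + 1 : ℝ)) • ξ)) ξ / (n + 1 : ℝ)) := by ring
    linarith
  · intro n
    simp only
    rw [← tele n]
    refine Finset.sum_le_sum fun i _ => ?_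
    have h1 := key ((i : ℝ) / (n + 1 : ℝ)) (((i + 1 : ℕ) : ℝ) / (n + 1 : ℝ))
    rw [hstep n i] at h1
    linarith [show 1 / (n + 1 : ℝ) * inner ℝ (a (((i : ℝ) / (n + 1 : ℝ)) • ξ)) ξ
      = inner ℝ (a (((i : ℝ) / (n + 1 : ℝ)) • ξ)) ξ / (n + 1 : ℝ) by ring]

end Gradient

section LpNorm

variable {X E : Type*} [MeasurableSpace X] {μ : Measure X} [NormedAddCommGroup E] {p : ℝ}

theorem integrable_norm_rpow_of_memLp (hp : 1 < p) {g : X → E}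
    (hg : MemLp g (ENNReal.ofReal p) μ) : Integrable (fun x => ‖g x‖ ^ p) μ := by
  have := hg.integrable_norm_rpow (by simp; linarith) ENNReal.ofReal_ne_top
  rwa [ENNReal.toReal_ofReal (by linarith)] at this

theorem tendsto_eLpNorm_zero_iff (hp : 1 < p) {ι : Type*} {l : Filter ι} {h : ι → X → E}
    (hh : ∀ k, MemLp (h k) (ENNReal.ofReal p) μ) :
    Tendsto (fun k => eLpNorm (h k) (ENNReal.ofReal p) μ) l (𝓝 0) ↔
      Tendsto (fun k => ∫ x, ‖h k x‖ ^ p ∂μ) l (𝓝 0) := by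
  have hp0 : 0 < p := by linarith
  have hN : ∀ k, 0 ≤ ∫ x, ‖h k x‖ ^ p ∂μ := fun k => integral_nonneg fun x => by positivity
  have he : ∀ k, eLpNorm (h k) (ENNReal.ofReal p) μ
      = ENNReal.ofReal ((∫ x, ‖h k x‖ ^ p ∂μ) ^ p⁻¹) := by
    intro k
    rw [(hh k).eLpNorm_eq_integral_rpow_norm (by simp; linarith) ENNReal.ofReal_ne_top,
      ENNReal.toReal_ofReal hp0.le]
  simp_rw [he]
  constructor
  · intro ht
    have h1 := (ENNReal.tendsto_toReal ENNReal.zero_ne_top).comp ht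
    have h2 : Tendsto (fun k => (∫ x, ‖h k x‖ ^ p ∂μ) ^ p⁻¹) l (𝓝 0) := by
      refine h1.congr fun k => ?_
      simp [ENNReal.toReal_ofReal (Real.rpow_nonneg (hN k) p⁻¹)]
    have h3 := h2.rpow_const (p := p) (Or.inr hp0.le)
    rw [Real.zero_rpow hp0.ne'] at h3
    refine h3.congr fun k => ?_
    rw [← Real.rpow_mul (hN k), inv_mul_cancel₀ hp0.ne', Real.rpow_one]
  · intro ht
    have h3 := ht.rpow_const (p := p⁻¹) (Or.inr (by positivity))
    rw [Real.zero_rpow (by positivity)] at h3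
    simpa using ENNReal.tendsto_ofReal h3

end LpNorm

section Integrand

variable {X E : Type*} [MeasurableSpace X] {μ : Measure X} [NormedAddCommGroup E]
  [NormedSpace ℝ E] {p c C : ℝ} {Φ : X → E → ℝ}

/-- `Φ` is an integrand with `c |ξ|^p ≤ Φ(x, ξ) ≤ C |ξ|^p`, convex and continuous in `ξ`.
Measurability is recorded in the form in which it is used: superposition with `Φ` preserves
measurability. -/
structure IsConvexIntegrand (μ : Measure X) (p c C : ℝ) (Φ : X → E → ℝ) : Prop where
  aestronglyMeasurable : ∀ g : X → E, AEStronglyMeasurable g μ →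
    AEStronglyMeasurable (fun x => Φ x (g x)) μ
  convex : ∀ᵐ x ∂μ, ConvexOn ℝ Set.univ (Φ x)
  continuous : ∀ᵐ x ∂μ, Continuous (Φ x)
  lower : ∀ᵐ x ∂μ, ∀ ξ, c * ‖ξ‖ ^ p ≤ Φ x ξ
  upper : ∀ᵐ x ∂μ, ∀ ξ, Φ x ξ ≤ C * ‖ξ‖ ^ p

/-- The energy `∫ Φ(x, g(x)) dμ`. -/
noncomputable def energy (μ : Measure X) (Φ : X → E → ℝ) (g : X → E) : ℝ := ∫ x, Φ x (g x) ∂μ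

namespace IsConvexIntegrand

theorem nonneg (hΦ : IsConvexIntegrand μ p c C Φ) (hc : 0 ≤ c) : ∀ᵐ x ∂μ, ∀ ξ, 0 ≤ Φ x ξ := by
  filter_upwards [hΦ.lower] with x hx ξ
  exact le_trans (by positivity) (hx ξ)

theorem integrable (hΦ : IsConvexIntegrand μ p c C Φ) (hc : 0 ≤ c) (hp : 1 < p) {g : X → E}
    (hg : MemLp g (ENNReal.ofReal p) μ) : Integrable (fun x => Φ x (g x)) μ := by
  refine ((integrable_norm_rpow_of_memLp hp hg).const_mul C).mono'
    (hΦ.aestronglyMeasurable g hg.1) ?_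
  filter_upwards [hΦ.nonneg hc, hΦ.upper] with x h0 h1
  rw [Real.norm_of_nonneg (h0 _)]
  exact h1 _

theorem energy_nonneg (hΦ : IsConvexIntegrand μ p c C Φ) (hc : 0 ≤ c) (g : X → E) :
    0 ≤ energy μ Φ g := by
  refine integral_nonneg_of_ae ?_
  filter_upwards [hΦ.nonneg hc] with x hx using hx _

theorem le_energy (hΦ : IsConvexIntegrand μ p c C Φ) (hc : 0 ≤ c) (hp : 1 < p) {g : X → E}
    (hg : MemLp g (ENNReal.ofReal p) μ) : c * ∫ x, ‖g x‖ ^ p ∂μ ≤ energy μ Φ g := by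
  rw [← integral_const_mul]
  refine integral_mono_ae ((integrable_norm_rpow_of_memLp hp hg).const_mul c)
    (hΦ.integrable hc hp hg) ?_
  filter_upwards [hΦ.lower] with x hx using hx _

theorem energy_le (hΦ : IsConvexIntegrand μ p c C Φ) (hc : 0 ≤ c) (hp : 1 < p) {g : X → E}
    (hg : MemLp g (ENNReal.ofReal p) μ) : energy μ Φ g ≤ C * ∫ x, ‖g x‖ ^ p ∂μ := by
  rw [← integral_const_mul]
  refine integral_mono_ae (hΦ.integrable hc hp hg)
    ((integrable_norm_rpow_of_memLp hp hg).const_mul C) ?_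
  filter_upwards [hΦ.upper] with x hx using hx _

/-- The point `ξ` is the convex combination with weights `r⁻¹` and `1 - r⁻¹` of `r η` and of a
multiple of `ξ - η`. -/
theorem le_smul_add {φ : E → ℝ} (hφ : ConvexOn ℝ Set.univ φ) (hn : ∀ ξ, 0 ≤ φ ξ)
    (hC : ∀ ξ, φ ξ ≤ C * ‖ξ‖ ^ p) {r : ℝ} (hr : 1 < r) (ξ η : E) :
    φ ξ ≤ φ (r • η) + C * (r / (r - 1)) ^ p * ‖ξ - η‖ ^ p := by
  have hr0 : 0 < r := by linarith
  have hr1 : 0 < r - 1 := by linarith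
  have hi : r⁻¹ ≤ 1 := inv_le_one_of_one_le₀ hr.le
  have hi0 : 0 < r⁻¹ := by positivity
  have h1 := hφ.2 (Set.mem_univ (r • η)) (Set.mem_univ ((r / (r - 1)) • (ξ - η)))
    hi0.le (sub_nonneg.2 hi) (by ring)
  have h2 : r⁻¹ • r • η + (1 - r⁻¹) • (r / (r - 1)) • (ξ - η) = ξ := by
    rw [smul_smul, smul_smul, inv_mul_cancel₀ hr0.ne',
      show (1 - r⁻¹) * (r / (r - 1)) = 1 by field_simp]
    simp
  rw [h2, smul_eq_mul, smul_eq_mul] at h1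
  have h3 := hC ((r / (r - 1)) • (ξ - η))
  rw [norm_smul, Real.norm_of_nonneg (by positivity), Real.mul_rpow (by positivity) (by positivity),
    ← mul_assoc] at h3
  have h4 : r⁻¹ * φ (r • η) ≤ φ (r • η) := mul_le_of_le_one_left (hn _) hi
  have h5 : (1 - r⁻¹) * φ ((r / (r - 1)) • (ξ - η)) ≤ φ ((r / (r - 1)) • (ξ - η)) :=
    mul_le_of_le_one_left (hn _) (by linarith)
  linarith

theorem energy_le_energy_smul_add (hΦ : IsConvexIntegrand μ p c C Φ) (hc : 0 ≤ c) (hp : 1 < p)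
    {g h : X → E} (hg : MemLp g (ENNReal.ofReal p) μ) (hh : MemLp h (ENNReal.ofReal p) μ)
    {r : ℝ} (hr : 1 < r) :
    energy μ Φ g ≤ energy μ Φ (fun x => r • h x)
      + C * (r / (r - 1)) ^ p * ∫ x, ‖g x - h x‖ ^ p ∂μ := by
  have i1 := hΦ.integrable hc hp (hh.const_smul r)
  have i2 := (integrable_norm_rpow_of_memLp hp (hg.sub hh)).const_mul (C * (r / (r - 1)) ^ p)
  have := integral_mono_ae (hΦ.integrable hc hp hg) (i1.add i2) (by
    filter_upwards [hΦ.convex, hΦ.nonneg hc, hΦ.upper] with x h1 h2 h3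
    exact le_smul_add h1 h2 h3 hr (g x) (h x))
  refine this.trans_eq ?_
  rw [← integral_const_mul]
  exact integral_add i1 i2

theorem tendsto_energy_smul (hΦ : IsConvexIntegrand μ p c C Φ) (hc : 0 ≤ c) (hcC : 0 ≤ C)
    (hp : 1 < p) {h : X → E} (hh : MemLp h (ENNReal.ofReal p) μ) :
    Tendsto (fun r : ℝ => energy μ Φ (fun x => r • h x)) (𝓝 1) (𝓝 (energy μ Φ h)) := by
  refine tendsto_integral_filter_of_dominated_convergence (fun x => C * (2 ^ p * ‖h x‖ ^ p)) ?_ ?_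
    (((integrable_norm_rpow_of_memLp hp hh).const_mul _).const_mul _) ?_
  · exact Eventually.of_forall fun r => hΦ.aestronglyMeasurable _ (hh.1.const_smul r)
  · have : ∀ᶠ r : ℝ in 𝓝 1, |r| ≤ 2 := by
      filter_upwards [Icc_mem_nhds (show (0 : ℝ) < 1 by norm_num) (show (1 : ℝ) < 2 by norm_num)]
        with r hr
      rw [abs_of_nonneg hr.1]
      exact hr.2
    filter_upwards [this] with r hr
    filter_upwards [hΦ.nonneg hc, hΦ.upper] with x h0 h1
    rw [Real.norm_of_nonneg (h0 _)]
    refine (h1 _).trans ?_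
    gcongr
    rw [norm_smul, ← Real.mul_rpow (by norm_num) (by positivity), Real.norm_eq_abs]
    gcongr
  · filter_upwards [hΦ.continuous] with x hx
    have : Tendsto (fun r : ℝ => r • h x) (𝓝 1) (𝓝 (h x)) := by
      have hcont : Continuous (fun r : ℝ => r • h x) := by fun_prop
      simpa using hcont.tendsto 1
    exact (hx.tendsto _).comp this

/-- The energy is continuous in `L^p`. Convexity replaces a domination argument: `Φ(h_k)` is at
most `Φ(r h)` plus a multiple of `|h_k - h|^p`, and `Φ(h / r)` at most `Φ(h_k)` plus such a term,
for every `r > 1`. -/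
theorem tendsto_energy (hΦ : IsConvexIntegrand μ p c C Φ) (hc : 0 ≤ c) (hcC : 0 ≤ C)
    (hp : 1 < p) {h : ℕ → X → E} {h' : X → E} (hh : ∀ k, MemLp (h k) (ENNReal.ofReal p) μ)
    (hh' : MemLp h' (ENNReal.ofReal p) μ)
    (hlim : Tendsto (fun k => ∫ x, ‖h k x - h' x‖ ^ p ∂μ) atTop (𝓝 0)) :
    Tendsto (fun k => energy μ Φ (h k)) atTop (𝓝 (energy μ Φ h')) := by
  have hE := hΦ.tendsto_energy_smul hc hcC hp hh'
  rw [tendsto_order]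
  constructor
  · intro e he
    have hinv : Tendsto (fun r : ℝ => r⁻¹) (𝓝[>] 1) (𝓝 1) := by
      have : Tendsto (fun r : ℝ => r⁻¹) (𝓝 1) (𝓝 (1 : ℝ)⁻¹) := tendsto_inv₀ one_ne_zero
      rw [inv_one] at this
      exact this.mono_left nhdsWithin_le_nhds
    obtain ⟨r, hr1, hr⟩ := (((hE.comp hinv).eventually (lt_mem_nhds he)).and
      self_mem_nhdsWithin).exists
    have hr' : (1 : ℝ) < r := hr
    have hr0 : r ≠ 0 := by linarith
    have h2 : Tendsto (fun k => energy μ Φ (fun x => r⁻¹ • h' x)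
        - C * (r / (r - 1)) ^ p * ((r⁻¹) ^ p * ∫ x, ‖h k x - h' x‖ ^ p ∂μ)) atTop
        (𝓝 (energy μ Φ (fun x => r⁻¹ • h' x))) := by
      simpa using tendsto_const_nhds.sub ((hlim.const_mul ((r⁻¹) ^ p)).const_mul
        (C * (r / (r - 1)) ^ p))
    filter_upwards [h2.eventually (lt_mem_nhds hr1)] with k hk
    refine hk.trans_le ?_
    have h3 := hΦ.energy_le_energy_smul_add hc hp (hh'.const_smul r⁻¹) ((hh k).const_smul r⁻¹) hr'
    have h4 : ∀ x, ‖(r⁻¹ • h') x - (r⁻¹ • h k) x‖ ^ p = (r⁻¹) ^ p * ‖h k x - h' x‖ ^ p := by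
      intro x
      have : (0 : ℝ) < r⁻¹ := by positivity
      rw [Pi.smul_apply, Pi.smul_apply, ← smul_sub, norm_smul, Real.norm_of_nonneg this.le,
        Real.mul_rpow this.le (norm_nonneg _), norm_sub_rev]
    simp_rw [h4, integral_const_mul] at h3
    simp only [Pi.smul_apply, smul_smul, mul_inv_cancel₀ hr0, one_smul] at h3
    have h5 : energy μ Φ (r⁻¹ • h') = energy μ Φ (fun x => r⁻¹ • h' x) := rfl
    rw [h5] at h3
    linarith
  · intro e he
    obtain ⟨r, hr1, hr⟩ := (((hE.mono_left nhdsWithin_le_nhds).eventually (gt_mem_nhds he)).and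
      (self_mem_nhdsWithin (a := (1 : ℝ)) (s := Set.Ioi 1))).exists
    have h2 : Tendsto (fun k => energy μ Φ (fun x => r • h' x)
        + C * (r / (r - 1)) ^ p * ∫ x, ‖h k x - h' x‖ ^ p ∂μ) atTop
        (𝓝 (energy μ Φ (fun x => r • h' x))) := by
      simpa using tendsto_const_nhds.add (hlim.const_mul (C * (r / (r - 1)) ^ p))
    filter_upwards [h2.eventually (gt_mem_nhds hr1)] with k hk
    exact (hΦ.energy_le_energy_smul_add hc hp (hh k) hh' hr).trans_lt hk

end IsConvexIntegrand

end Integrand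

/-- The potential of a variational operator is a convex integrand. Its measurability in `x` is
inherited from `a`, by way of the Riemann sums of `t ↦ ⟪a(x, t ξ), ξ⟫`. -/
theorem IsVariationalOperator.isConvexIntegrand {N : ℕ} {Ω : Set (Rn N)} {p : ℝ}
    {Φ : Rn N → Rn N → ℝ} {a : Rn N → Rn N → Rn N} (ha : IsVariationalOperator Ω p Φ a)
    {α β : ℝ} (hg : ∀ᵐ x ∂(volume.restrict Ω), ∀ ξ,
      α / p * ‖ξ‖ ^ p ≤ Φ x ξ ∧ Φ x ξ ≤ β / p * ‖ξ‖ ^ p) :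
    IsConvexIntegrand (volume.restrict Ω) p (α / p) (β / p) Φ where
  aestronglyMeasurable g hgm := by
    have hm : ∀ n : ℕ, AEMeasurable (fun x => ∑ i ∈ Finset.range (n + 1),
        inner ℝ (a x (((i : ℝ) / (n + 1 : ℝ)) • g x)) (g x) / (n + 1 : ℝ))
        (volume.restrict Ω) := by
      intro n
      refine Finset.aemeasurable_fun_sum _ fun i _ => ?_
      have := aemeasurable_caratheodory_comp ha.caratheodory.measurable ha.caratheodory.continuous
        (hgm.const_smul ((i : ℝ) / (n + 1 : ℝ)))
      exact (this.inner hgm.aemeasurable).div_const _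
    refine (aemeasurable_of_tendsto_metrizable_ae atTop hm ?_).aestronglyMeasurable
    filter_upwards [ha.potential, ha.strictConvex] with x h1 h2
    simpa [h1.1] using tendsto_riemannSum_gradient h2.convexOn h1.2 (g x)
  convex := ha.strictConvex.mono fun x hx => hx.convexOn
  continuous := ha.potential.mono fun x hx => continuous_iff_continuousAt.2
    fun ξ => (hx.2 ξ).hasFDerivAt.continuousAt
  lower := hg.mono fun x hx ξ => (hx ξ).1
  upper := hg.mono fun x hx ξ => (hx ξ).2

/-! ### Uniform convexity of the `L^p` norm -/

section UniformConvexity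

theorem norm_midpoint_rpow_lt {E : Type*} [NormedAddCommGroup E] [NormedSpace ℝ E]
    [StrictConvexSpace ℝ E] {p : ℝ} (hp : 1 < p) {ξ η : E} (h : ξ ≠ η) :
    ‖(1 / 2 : ℝ) • (ξ + η)‖ ^ p < (‖ξ‖ ^ p + ‖η‖ ^ p) / 2 := by
  have hp0 : 0 < p := by linarith
  have hn : ‖(1 / 2 : ℝ) • (ξ + η)‖ = 1 / 2 * ‖ξ + η‖ := by
    rw [norm_smul]; norm_num
  by_cases hne : ‖ξ‖ = ‖η‖
  · have h1 : ‖ξ + η‖ < ‖ξ‖ + ‖η‖ := by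
      refine lt_of_le_of_ne (norm_add_le _ _) fun h2 => h ?_
      exact (sameRay_iff_norm_add.2 h2).eq_of_norm_eq hne
    rw [hn, hne, ← two_mul, mul_div_cancel_left₀ _ (two_ne_zero' ℝ)]
    apply Real.rpow_lt_rpow (by positivity) _ hp0
    rw [hne] at h1
    linarith
  · have h1 := (strictConvexOn_rpow hp).2 (norm_nonneg ξ) (norm_nonneg η) hne
      (show (0 : ℝ) < 1 / 2 by norm_num) (show (0 : ℝ) < 1 / 2 by norm_num) (by norm_num)
    simp only [smul_eq_mul] at h1
    have h2 : ‖(1 / 2 : ℝ) • (ξ + η)‖ ^ p ≤ (1 / 2 * ‖ξ‖ + 1 / 2 * ‖η‖) ^ p := by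
      apply Real.rpow_le_rpow (norm_nonneg _) _ hp0.le
      rw [hn]
      linarith [norm_add_le ξ η]
    linarith

/-- The convexity defect of `|·|^p` at the midpoint controls `|ξ - η|^p`, up to a small multiple of
`|ξ|^p + |η|^p`: on the compact set where `|ξ|^p + |η|^p = 1` and `|ξ - η|^p ≥ ε`, the defect is
bounded below, and both sides are homogeneous. -/
theorem exists_norm_sub_rpow_le {E : Type*} [NormedAddCommGroup E] [NormedSpace ℝ E]
    [StrictConvexSpace ℝ E] [FiniteDimensional ℝ E] {p : ℝ} (hp : 1 < p) {ε : ℝ} (hε : 0 < ε) :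
    ∃ K : ℝ, 0 ≤ K ∧ ∀ ξ η : E, ‖ξ - η‖ ^ p ≤ ε * (‖ξ‖ ^ p + ‖η‖ ^ p)
      + K * ((‖ξ‖ ^ p + ‖η‖ ^ p) / 2 - ‖(1 / 2 : ℝ) • (ξ + η)‖ ^ p) := by
  have hp0 : 0 < p := by linarith
  have : ProperSpace E := FiniteDimensional.proper_real E
  have hD0 : ∀ ξ η : E, 0 ≤ (‖ξ‖ ^ p + ‖η‖ ^ p) / 2 - ‖(1 / 2 : ℝ) • (ξ + η)‖ ^ p := by
    intro ξ η
    by_cases h : ξ = η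
    · subst h
      rw [← two_smul ℝ ξ, smul_smul]
      norm_num
    · linarith [norm_midpoint_rpow_lt hp h]
  have hcpow : Continuous fun t : ℝ => t ^ p := Real.continuous_rpow_const hp0.le
  set D : E × E → ℝ := fun z => (‖z.1‖ ^ p + ‖z.2‖ ^ p) / 2 - ‖(1 / 2 : ℝ) • (z.1 + z.2)‖ ^ p with hD
  have hDc : Continuous D := by
    have h1 : Continuous fun z : E × E => ‖z.1‖ ^ p := hcpow.comp (by fun_prop)
    have h2 : Continuous fun z : E × E => ‖z.2‖ ^ p := hcpow.comp (by fun_prop)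
    have h3 : Continuous fun z : E × E => ‖(1 / 2 : ℝ) • (z.1 + z.2)‖ ^ p :=
      hcpow.comp (by fun_prop)
    exact ((h1.add h2).div_const 2).sub h3
  have hSc : Continuous fun z : E × E => ‖z.1‖ ^ p + ‖z.2‖ ^ p :=
    (hcpow.comp (by fun_prop : Continuous fun z : E × E => ‖z.1‖)).add
      (hcpow.comp (by fun_prop : Continuous fun z : E × E => ‖z.2‖))
  have hdc : Continuous fun z : E × E => ‖z.1 - z.2‖ ^ p := hcpow.comp (by fun_prop)
  set S : Set (E × E) := {z | ‖z.1‖ ^ p + ‖z.2‖ ^ p = 1 ∧ ε ≤ ‖z.1 - z.2‖ ^ p} with hS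
  have hle1 : ∀ z : E × E, ‖z.1‖ ^ p + ‖z.2‖ ^ p = 1 → ‖z.1‖ ≤ 1 ∧ ‖z.2‖ ≤ 1 := by
    intro z hz
    have a1 : 0 ≤ ‖z.1‖ ^ p := by positivity
    have a2 : 0 ≤ ‖z.2‖ ^ p := by positivity
    constructor <;> by_contra! hcon
    · linarith [Real.one_lt_rpow hcon hp0]
    · linarith [Real.one_lt_rpow hcon hp0]
  have hScomp : IsCompact S := by
    refine Metric.isCompact_of_isClosed_isBounded ?_ ?_
    · exact (isClosed_eq hSc continuous_const).inter (isClosed_le continuous_const hdc)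
    · refine (Metric.isBounded_closedBall (x := (0 : E × E)) (r := 1)).subset fun z hz => ?_
      have := hle1 z hz.1
      rw [mem_closedBall_zero_iff, Prod.norm_def]
      exact max_le this.1 this.2
  have key : ∃ K : ℝ, 0 ≤ K ∧ ∀ z : E × E, ‖z.1‖ ^ p + ‖z.2‖ ^ p = 1 →
      ‖z.1 - z.2‖ ^ p ≤ ε + K * D z := by
    rcases S.eq_empty_or_nonempty with hem | hne
    · refine ⟨0, le_rfl, fun z hz => ?_⟩
      by_contra! hcon
      have : z ∈ S := ⟨hz, by linarith⟩
      simp [hem] at this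
    · obtain ⟨z₀, hz₀, hmin⟩ := hScomp.exists_isMinOn hne hDc.continuousOn
      have hδ : 0 < D z₀ := by
        have hne' : z₀.1 ≠ z₀.2 := by
          intro heq
          have := hz₀.2
          rw [heq, sub_self, norm_zero, Real.zero_rpow hp0.ne'] at this
          linarith
        have := norm_midpoint_rpow_lt hp hne'
        simp only [hD]
        linarith
      refine ⟨2 ^ p / D z₀, by positivity, fun z hz => ?_⟩
      by_cases hzS : ε ≤ ‖z.1 - z.2‖ ^ p
      · have h1 : D z₀ ≤ D z := hmin ⟨hz, hzS⟩
        have h2 : ‖z.1 - z.2‖ ^ p ≤ 2 ^ p := by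
          apply Real.rpow_le_rpow (norm_nonneg _) _ hp0.le
          linarith [norm_sub_le z.1 z.2, (hle1 z hz).1, (hle1 z hz).2]
        have h3 : (2 : ℝ) ^ p = 2 ^ p / D z₀ * D z₀ := by field_simp
        have h4 : 2 ^ p / D z₀ * D z₀ ≤ 2 ^ p / D z₀ * D z := by gcongr
        linarith
      · have : 0 ≤ 2 ^ p / D z₀ * D z := mul_nonneg (by positivity) (hD0 _ _)
        linarith
  obtain ⟨K, hK, hKz⟩ := key
  refine ⟨K, hK, fun ξ η => ?_⟩
  have hT0 : 0 ≤ ‖ξ‖ ^ p + ‖η‖ ^ p := by positivity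
  rcases hT0.eq_or_lt with hT | hT
  · have a1 : 0 ≤ ‖ξ‖ ^ p := by positivity
    have a2 : 0 ≤ ‖η‖ ^ p := by positivity
    have h1 : ‖ξ‖ = 0 := (Real.rpow_eq_zero (norm_nonneg _) hp0.ne').1 (by linarith)
    have h2 : ‖η‖ = 0 := (Real.rpow_eq_zero (norm_nonneg _) hp0.ne').1 (by linarith)
    rw [norm_eq_zero] at h1 h2
    simp [h1, h2, Real.zero_rpow hp0.ne']
  · set T := ‖ξ‖ ^ p + ‖η‖ ^ p with hTdef
    -- normalise by the factor `s` with `s ^ p = T⁻¹`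
    set s : ℝ := (T⁻¹) ^ p⁻¹ with hs
    have hs0 : 0 < s := by positivity
    have hsp : s ^ p = T⁻¹ := by
      rw [hs, ← Real.rpow_mul (by positivity), inv_mul_cancel₀ hp0.ne', Real.rpow_one]
    have hsm : ∀ w : E, ‖s • w‖ ^ p = T⁻¹ * ‖w‖ ^ p := by
      intro w
      rw [norm_smul, Real.norm_of_nonneg hs0.le, Real.mul_rpow hs0.le (norm_nonneg _), hsp]
    have h1 := hKz (s • ξ, s • η) (by
      simp only [hsm]
      rw [← mul_add, ← hTdef, inv_mul_cancel₀ hT.ne'])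
    simp only [hD] at h1
    rw [← smul_sub, ← smul_add, smul_comm (1 / 2 : ℝ) s, hsm, hsm, hsm, hsm] at h1
    have h2 : T * (T⁻¹ * ‖ξ - η‖ ^ p) ≤ T * (ε + K * ((T⁻¹ * ‖ξ‖ ^ p + T⁻¹ * ‖η‖ ^ p) / 2
      - T⁻¹ * ‖(1 / 2 : ℝ) • (ξ + η)‖ ^ p)) := mul_le_mul_of_nonneg_left h1 hT.le
    have h3 : T * (T⁻¹ * ‖ξ - η‖ ^ p) = ‖ξ - η‖ ^ p := by field_simp
    have h4 : T * (ε + K * ((T⁻¹ * ‖ξ‖ ^ p + T⁻¹ * ‖η‖ ^ p) / 2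
      - T⁻¹ * ‖(1 / 2 : ℝ) • (ξ + η)‖ ^ p)) = ε * T + K * (T / 2 - ‖(1 / 2 : ℝ) • (ξ + η)‖ ^ p) := by
      have hTi : T * T⁻¹ = 1 := mul_inv_cancel₀ hT.ne'
      linear_combination (K * ((‖ξ‖ ^ p + ‖η‖ ^ p) / 2 - ‖(1 / 2 : ℝ) • (ξ + η)‖ ^ p)) * hTi
        - K / 2 * hTdef
    rwa [h3, h4] at h2

variable {X E : Type*} [MeasurableSpace X] {μ : Measure X} [NormedAddCommGroup E]
  [NormedSpace ℝ E] [StrictConvexSpace ℝ E] [FiniteDimensional ℝ E] {p : ℝ}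

/-- A decreasing sequence of nonempty midpoint-convex sets that meet a fixed ball of `L^p` has
points `h n ∈ S n` that converge in `L^p`: elements of almost minimal norm form a Cauchy sequence. -/
theorem exists_tendsto_of_antitone_midpoint (hp : 1 < p) {S : ℕ → Set (X → E)}
    (hanti : Antitone S) (hmem : ∀ n, ∀ h ∈ S n, MemLp h (ENNReal.ofReal p) μ)
    (hmid : ∀ n, ∀ h ∈ S n, ∀ h' ∈ S n, (fun x => (1 / 2 : ℝ) • (h x + h' x)) ∈ S n)
    {R : ℝ} (hR : ∀ n, ∃ h ∈ S n, ∫ x, ‖h x‖ ^ p ∂μ ≤ R) :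
    ∃ h : ℕ → X → E, (∀ n, h n ∈ S n) ∧ ∃ g, MemLp g (ENNReal.ofReal p) μ ∧
      Tendsto (fun n => ∫ x, ‖h n x - g x‖ ^ p ∂μ) atTop (𝓝 0) := by
  have hp0 : 0 < p := by linarith
  have : Fact (1 ≤ ENNReal.ofReal p) := ⟨ENNReal.one_le_ofReal.2 hp.le⟩
  have : CompleteSpace E := FiniteDimensional.complete ℝ E
  set V : ℕ → Set ℝ := fun n => (fun h : X → E => ∫ x, ‖h x‖ ^ p ∂μ) '' S n with hV
  have hVb : ∀ n, BddBelow (V n) := by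
    intro n
    refine ⟨0, ?_⟩
    rintro _ ⟨h, -, rfl⟩
    exact integral_nonneg fun x => by positivity
  have hVne : ∀ n, (V n).Nonempty := fun n => by
    obtain ⟨h, hh, -⟩ := hR n
    exact ⟨_, h, hh, rfl⟩
  set I : ℕ → ℝ := fun n => sInf (V n) with hI
  have hImono : Monotone I := fun m n hmn =>
    csInf_le_csInf (hVb m) (hVne n) (Set.image_mono (hanti hmn))
  have hIR : ∀ n, I n ≤ R := fun n => by
    obtain ⟨h, hh, hle⟩ := hR n
    exact (csInf_le (hVb n) ⟨h, hh, rfl⟩).trans hle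
  have hIbdd : BddAbove (Set.range I) := ⟨R, by rintro _ ⟨n, rfl⟩; exact hIR n⟩
  have hIlim := tendsto_atTop_ciSup hImono hIbdd
  set L := ⨆ n, I n with hL
  have hIL : ∀ n, I n ≤ L := fun n => le_ciSup hIbdd n
  have hch : ∀ n, ∃ h ∈ S n, ∫ x, ‖h x‖ ^ p ∂μ < I n + 1 / (n + 1 : ℝ) := by
    intro n
    obtain ⟨_, ⟨h, hh, rfl⟩, hlt⟩ := exists_lt_of_csInf_lt (hVne n)
      (show sInf (V n) < I n + 1 / (n + 1 : ℝ) from lt_add_of_pos_right _ (by positivity))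
    exact ⟨h, hh, hlt⟩
  choose h hhS hhI using hch
  have hL1 : ∀ n, ∫ x, ‖h n x‖ ^ p ∂μ ≤ L + 1 / (n + 1 : ℝ) := fun n =>
    (hhI n).le.trans (by linarith [hIL n])
  have hL2 : ∀ n, ∫ x, ‖h n x‖ ^ p ∂μ ≤ L + 1 := fun n => (hL1 n).trans (by
    have : 1 / (n + 1 : ℝ) ≤ 1 := by
      rw [div_le_one (by positivity)]
      linarith [(Nat.cast_nonneg n : (0 : ℝ) ≤ n)]
    linarith)
  have hLnn : 0 ≤ L + 1 := le_trans (integral_nonneg fun x => by positivity) (hL2 0)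
  have hint : ∀ n, Integrable (fun x => ‖h n x‖ ^ p) μ := fun n =>
    integrable_norm_rpow_of_memLp hp (hmem n _ (hhS n))
  have hcauchy : ∀ δ : ℝ, 0 < δ → ∃ n₀, ∀ i ≥ n₀, ∀ j ≥ n₀, ∫ x, ‖h i x - h j x‖ ^ p ∂μ < δ := by
    intro δ hδ
    set ε := δ / (4 * (L + 1) + 4) with hε
    have hεpos : 0 < ε := by positivity
    obtain ⟨K, hK, hKle⟩ := exists_norm_sub_rpow_le (E := E) hp hεpos
    have hsmall : Tendsto (fun n : ℕ => K * (L + 1 / (n + 1 : ℝ) - I n)) atTop (𝓝 0) := by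
      have := ((tendsto_const_nhds (x := L)).add
        (tendsto_one_div_add_atTop_nhds_zero_nat (𝕜 := ℝ))).sub hIlim
      simpa using this.const_mul K
    obtain ⟨n₀, hn₀⟩ := eventually_atTop.1 (hsmall.eventually (gt_mem_nhds (half_pos hδ)))
    refine ⟨n₀, fun i hi j hj => ?_⟩
    have hS0 : ∀ k ≥ n₀, h k ∈ S n₀ := fun k hk => hanti hk (hhS k)
    have hmid' := hmid n₀ _ (hS0 i hi) _ (hS0 j hj)
    have hI1 : I n₀ ≤ ∫ x, ‖(1 / 2 : ℝ) • (h i x + h j x)‖ ^ p ∂μ :=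
      csInf_le (hVb n₀) ⟨_, hmid', rfl⟩
    have hk1 : ∀ k ≥ n₀, ∫ x, ‖h k x‖ ^ p ∂μ ≤ L + 1 / (n₀ + 1 : ℝ) := fun k hk =>
      (hL1 k).trans (by
        have : 1 / (k + 1 : ℝ) ≤ 1 / (n₀ + 1 : ℝ) := by
          apply one_div_le_one_div_of_le (by positivity)
          have : (n₀ : ℝ) ≤ k := by exact_mod_cast hk
          linarith
        linarith)
    have hint3 := integrable_norm_rpow_of_memLp hp (hmem _ _ hmid')
    have hintd := integrable_norm_rpow_of_memLp hp ((hmem _ _ (hhS i)).sub (hmem _ _ (hhS j)))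
    have hle : ∫ x, ‖h i x - h j x‖ ^ p ∂μ ≤ ε * (∫ x, ‖h i x‖ ^ p ∂μ + ∫ x, ‖h j x‖ ^ p ∂μ)
        + K * ((∫ x, ‖h i x‖ ^ p ∂μ + ∫ x, ‖h j x‖ ^ p ∂μ) / 2
          - ∫ x, ‖(1 / 2 : ℝ) • (h i x + h j x)‖ ^ p ∂μ) := by
      have ia : Integrable (fun x => ‖h i x‖ ^ p + ‖h j x‖ ^ p) μ := (hint i).add (hint j)
      have ib : Integrable (fun x => (‖h i x‖ ^ p + ‖h j x‖ ^ p) / 2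
        - ‖(1 / 2 : ℝ) • (h i x + h j x)‖ ^ p) μ := (ia.div_const 2).sub hint3
      rw [← integral_add (hint i) (hint j), ← integral_div, ← integral_const_mul,
        ← integral_sub (ia.div_const 2) hint3, ← integral_const_mul,
        ← integral_add (ia.const_mul ε) (ib.const_mul K)]
      refine integral_mono hintd ((ia.const_mul ε).add (ib.const_mul K)) fun x => ?_
      exact hKle (h i x) (h j x)
    have h1 : ε * (∫ x, ‖h i x‖ ^ p ∂μ + ∫ x, ‖h j x‖ ^ p ∂μ) ≤ ε * (2 * (L + 1)) := by
      apply mul_le_mul_of_nonneg_left _ hεpos.le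
      linarith [hL2 i, hL2 j]
    have h2 : ε * (2 * (L + 1)) < δ / 2 := by
      rw [hε, div_mul_eq_mul_div, div_lt_iff₀ (by positivity)]
      nlinarith
    have h3 : K * ((∫ x, ‖h i x‖ ^ p ∂μ + ∫ x, ‖h j x‖ ^ p ∂μ) / 2
          - ∫ x, ‖(1 / 2 : ℝ) • (h i x + h j x)‖ ^ p ∂μ) ≤ K * (L + 1 / (n₀ + 1 : ℝ) - I n₀) := by
      apply mul_le_mul_of_nonneg_left _ hK
      linarith [hk1 i hi, hk1 j hj]
    linarith [hn₀ n₀ le_rfl]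
  refine ⟨h, hhS, ?_⟩
  set hL' : ℕ → Lp E (ENNReal.ofReal p) μ := fun n => (hmem n _ (hhS n)).toLp (h n) with hLdef
  have hCS : CauchySeq hL' := by
    rw [Metric.cauchySeq_iff]
    intro δ hδ
    obtain ⟨n₀, hn₀⟩ := hcauchy (δ ^ p) (by positivity)
    refine ⟨n₀, fun i hi j hj => ?_⟩
    have hsub := (hmem _ _ (hhS i)).sub (hmem _ _ (hhS j))
    rw [dist_eq_norm, hLdef]
    simp only
    rw [← MemLp.toLp_sub, Lp.norm_toLp,
      hsub.eLpNorm_eq_integral_rpow_norm (by simp; linarith) ENNReal.ofReal_ne_top,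
      ENNReal.toReal_ofReal hp0.le,
      ENNReal.toReal_ofReal (Real.rpow_nonneg (integral_nonneg fun x => by positivity) _)]
    rw [← Real.rpow_inv_rpow hδ.le hp0.ne', ← Real.rpow_mul hδ.le, mul_comm, Real.rpow_mul hδ.le]
    exact Real.rpow_lt_rpow (integral_nonneg fun x => by positivity) (hn₀ i hi j hj) (by positivity)
  obtain ⟨g, hg⟩ := cauchySeq_tendsto_of_complete hCS
  refine ⟨g, Lp.memLp g, ?_⟩
  have h1 := (Lp.tendsto_Lp_iff_tendsto_eLpNorm' _ _).1 hg
  have h2 : Tendsto (fun n => eLpNorm (fun x => h n x - g x) (ENNReal.ofReal p) μ) atTop (𝓝 0) := by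
    refine h1.congr fun n => ?_
    refine eLpNorm_congr_ae ?_
    exact (MemLp.coeFn_toLp (hmem n _ (hhS n))).sub (ae_eq_refl _)
  exact (tendsto_eLpNorm_zero_iff hp fun n => (hmem n _ (hhS n)).sub (Lp.memLp g)).1 h2

end UniformConvexity

/-! ### Compactness of bounded sequences of test functions -/

section Compactness

theorem lintegral_enorm_translate_sub_le {E : Type*} [NormedAddCommGroup E] [NormedSpace ℝ E]
    [MeasurableSpace E] [BorelSpace E] [FiniteDimensional ℝ E] {μ : Measure E} [SFinite μ]
    [μ.IsAddRightInvariant] {v : E → ℝ} (hv : ContDiff ℝ 1 v) (h : E) :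
    ∫⁻ x, ‖v x - v (x + h)‖ₑ ∂μ ≤ ‖h‖ₑ * ∫⁻ x, ‖fderiv ℝ v x‖ₑ ∂μ := by
  have hfc : Continuous (fderiv ℝ v) := hv.continuous_fderiv one_ne_zero
  have hpt : ∀ x, ‖v x - v (x + h)‖ₑ ≤ ∫⁻ t in Set.Ioc (0 : ℝ) 1, ‖fderiv ℝ v (x + t • h)‖ₑ * ‖h‖ₑ := by
    intro x
    have hd : ∀ t ∈ Set.uIcc (0 : ℝ) 1, HasDerivAt (fun t : ℝ => v (x + t • h))
        (fderiv ℝ v (x + t • h) h) t := by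
      intro t _
      have h1 : HasDerivAt (fun t : ℝ => x + t • h) h t := by
        simpa using ((hasDerivAt_id t).smul_const h).const_add x
      exact ((hv.differentiable one_ne_zero) _).hasFDerivAt.comp_hasDerivAt t h1
    have hcont : Continuous fun t : ℝ => fderiv ℝ v (x + t • h) h :=
      (hfc.comp (by fun_prop)).clm_apply continuous_const
    have hI := intervalIntegral.integral_eq_sub_of_hasDerivAt hd (hcont.intervalIntegrable 0 1)
    simp only [one_smul, zero_smul, add_zero] at hI
    rw [← enorm_neg, neg_sub, ← hI, intervalIntegral.integral_of_le zero_le_one]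
    refine (enorm_integral_le_lintegral_enorm _).trans (lintegral_mono fun t => ?_)
    exact (fderiv ℝ v (x + t • h)).le_opENorm h
  have hmeas : AEMeasurable (Function.uncurry fun (x : E) (t : ℝ) =>
      ‖fderiv ℝ v (x + t • h)‖ₑ * ‖h‖ₑ) (μ.prod (volume.restrict (Set.Ioc (0 : ℝ) 1))) := by
    have : Continuous (Function.uncurry fun (x : E) (t : ℝ) => fderiv ℝ v (x + t • h)) :=
      hfc.comp (by fun_prop)
    exact (this.enorm.measurable.mul_const _).aemeasurable
  calc ∫⁻ x, ‖v x - v (x + h)‖ₑ ∂μ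
      ≤ ∫⁻ x, (∫⁻ t in Set.Ioc (0 : ℝ) 1, ‖fderiv ℝ v (x + t • h)‖ₑ * ‖h‖ₑ) ∂μ :=
        lintegral_mono hpt
    _ = ∫⁻ t in Set.Ioc (0 : ℝ) 1, (∫⁻ x, ‖fderiv ℝ v (x + t • h)‖ₑ * ‖h‖ₑ ∂μ) :=
        lintegral_lintegral_swap hmeas
    _ = ∫⁻ _ in Set.Ioc (0 : ℝ) 1, (‖h‖ₑ * ∫⁻ x, ‖fderiv ℝ v x‖ₑ ∂μ) := by
        refine lintegral_congr fun t => ?_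
        rw [lintegral_mul_const' _ _ enorm_ne_top, mul_comm,
          lintegral_add_right_eq_self (fun x => ‖fderiv ℝ v x‖ₑ) (t • h)]
    _ = ‖h‖ₑ * ∫⁻ x, ‖fderiv ℝ v x‖ₑ ∂μ := by simp

/-- A function differs in `L¹` from its averages over balls of radius `r` by at most `r` times the
`L¹` norm of its derivative. The averages are left unnormalised. -/
theorem lintegral_enorm_sub_integral_ball_le {E : Type*} [NormedAddCommGroup E] [NormedSpace ℝ E]
    [MeasurableSpace E] [BorelSpace E] [FiniteDimensional ℝ E] {μ : Measure E}
    [μ.IsAddHaarMeasure] {v : E → ℝ} (hv : ContDiff ℝ 1 v) (r : ℝ) :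
    ∫⁻ x, ‖(μ (Metric.ball 0 r)).toReal * v x - ∫ h in Metric.ball 0 r, v (x + h) ∂μ‖ₑ ∂μ
      ≤ μ (Metric.ball 0 r) * (ENNReal.ofReal r * ∫⁻ x, ‖fderiv ℝ v x‖ₑ ∂μ) := by
  have : ProperSpace E := FiniteDimensional.proper_real E
  have hfin : μ (Metric.ball (0 : E) r) ≠ ⊤ := measure_ball_lt_top.ne
  have hpt : ∀ x, ‖(μ (Metric.ball 0 r)).toReal * v x - ∫ h in Metric.ball 0 r, v (x + h) ∂μ‖ₑ
      ≤ ∫⁻ h in Metric.ball 0 r, ‖v x - v (x + h)‖ₑ ∂μ := by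
    intro x
    have hi : IntegrableOn (fun h => v (x + h)) (Metric.ball 0 r) μ :=
      ((hv.continuous.comp (by fun_prop : Continuous fun h => x + h)).locallyIntegrable.integrableOn_isCompact
        (isCompact_closedBall 0 r)).mono_set Metric.ball_subset_closedBall
    have hconst : (μ (Metric.ball 0 r)).toReal * v x = ∫ _ in Metric.ball (0 : E) r, v x ∂μ := by
      simp [measureReal_def]
    have hi0 : IntegrableOn (fun _ => v x) (Metric.ball 0 r) μ := integrableOn_const hfin
    rw [hconst, ← integral_sub hi0 hi]
    exact enorm_integral_le_lintegral_enorm _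
  have hmeas : AEMeasurable (Function.uncurry fun (x h : E) => ‖v x - v (x + h)‖ₑ)
      (μ.prod (μ.restrict (Metric.ball 0 r))) := by
    have : Continuous (Function.uncurry fun (x h : E) => v x - v (x + h)) := by
      have := hv.continuous
      fun_prop
    exact this.enorm.measurable.aemeasurable
  calc _ ≤ ∫⁻ x, ∫⁻ h in Metric.ball 0 r, ‖v x - v (x + h)‖ₑ ∂μ ∂μ := lintegral_mono hpt
    _ = ∫⁻ h in Metric.ball 0 r, ∫⁻ x, ‖v x - v (x + h)‖ₑ ∂μ ∂μ := lintegral_lintegral_swap hmeas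
    _ ≤ ∫⁻ _ in Metric.ball (0 : E) r, ENNReal.ofReal r * ∫⁻ x, ‖fderiv ℝ v x‖ₑ ∂μ ∂μ := by
        refine setLIntegral_mono' measurableSet_ball fun h hh => ?_
        refine (lintegral_enorm_translate_sub_le hv h).trans ?_
        gcongr
        rw [← ofReal_norm]
        exact ENNReal.ofReal_le_ofReal (by simpa using (mem_ball_zero_iff.1 hh).le)
    _ = _ := by
        rw [setLIntegral_const, mul_comm]

/-- A uniformly bounded sequence of functions on a finite measure space has a subsequence whose
integrals over every measurable set converge, by weak compactness of balls in `L²`. -/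
theorem exists_subseq_tendsto_setIntegral {X : Type*} [MeasurableSpace X] {μ : Measure X}
    [IsFiniteMeasure μ] [IsSeparable μ] {v : ℕ → X → ℝ}
    (hm : ∀ k, AEStronglyMeasurable (v k) μ) {B : ℝ} (hB : ∀ k x, ‖v k x‖ ≤ B) :
    ∃ σ : ℕ → ℕ, StrictMono σ ∧ ∀ s, MeasurableSet s →
      ∃ b : ℝ, Tendsto (fun k => ∫ x in s, v (σ k) x ∂μ) atTop (𝓝 b) := by
  have hmem : ∀ k, MemLp (v k) 2 μ := fun k =>
    MemLp.of_bound (hm k) B (Eventually.of_forall (hB k))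
  obtain ⟨R, hR⟩ : ∃ R : ℝ, ∀ k, ‖(hmem k).toLp (v k)‖ ≤ R := by
    refine ⟨(μ Set.univ ^ (2 : ℝ≥0∞).toReal⁻¹ * ENNReal.ofReal B).toReal, fun k => ?_⟩
    rw [Lp.norm_toLp]
    refine ENNReal.toReal_mono (ENNReal.mul_ne_top
      (ENNReal.rpow_ne_top_of_nonneg (by positivity) (measure_ne_top _ _)) ENNReal.ofReal_ne_top) ?_
    exact eLpNorm_le_of_ae_bound (Eventually.of_forall (hB k))
  have : Fact ((2 : ℝ≥0∞) ≠ ⊤) := ⟨by simp⟩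
  set w : ℕ → WeakDual ℝ (Lp ℝ 2 μ) := fun k =>
    StrongDual.toWeakDual (innerSL ℝ ((hmem k).toLp (v k))) with hw
  obtain ⟨L, -, σ, hσ, hlim⟩ := WeakDual.isSeqCompact_closedBall ℝ (Lp ℝ 2 μ) 0 R
    (x := w) (fun k => by
      simp only [Set.mem_preimage, mem_closedBall_zero_iff, hw]
      refine le_trans ?_ (hR k)
      exact (innerSL_apply_norm (𝕜 := ℝ) _).le)
  refine ⟨σ, hσ, fun s hs => ?_⟩
  refine ⟨L (indicatorConstLp 2 hs (measure_ne_top μ s) (1 : ℝ)), ?_⟩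
  have h1 := ((WeakDual.eval_continuous
    (indicatorConstLp 2 hs (measure_ne_top μ s) (1 : ℝ))).tendsto L).comp hlim
  refine h1.congr fun k => ?_
  have h2 : (w (σ k)) (indicatorConstLp 2 hs (measure_ne_top μ s) (1 : ℝ))
      = inner ℝ ((hmem (σ k)).toLp (v (σ k)))
        (indicatorConstLp 2 hs (measure_ne_top μ s) (1 : ℝ)) := rfl
  simp only [Function.comp_apply]
  rw [h2, real_inner_comm, L2.inner_indicatorConstLp_one]
  exact setIntegral_congr_ae hs ((hmem (σ k)).coeFn_toLp.mono fun x hx _ => hx)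

theorem IsTestFunction.eq_zero_of_notMem {N : ℕ} {Ω : Set (Rn N)} {φ : Rn N → ℝ}
    (h : IsTestFunction Ω φ) {x : Rn N} (hx : x ∉ Ω) : φ x = 0 :=
  image_eq_zero_of_notMem_tsupport fun hx' => hx (h.support_subset hx')

/-- A sequence of test functions, bounded uniformly and in `W^{1,1}`, has an almost everywhere
convergent subsequence. Along a weakly convergent subsequence the averages over balls of radius `r`
converge in `L¹`, and they are `O(r)`-close to the functions themselves. -/
theorem exists_subseq_tendsto_ae {N : ℕ} {Ω : Set (Rn N)}
    (hb : Bornology.IsBounded Ω) {φ : ℕ → Rn N → ℝ} (hφ : ∀ k, IsTestFunction Ω (φ k)) {B : ℝ}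
    (hB : ∀ k x, ‖φ k x‖ ≤ B) {G : ℝ≥0∞} (hG : G ≠ ⊤) (hφG : ∀ k, ∫⁻ x, ‖fderiv ℝ (φ k) x‖ₑ ≤ G) :
    ∃ σ : ℕ → ℕ, StrictMono σ ∧ ∃ u : Rn N → ℝ,
      AEStronglyMeasurable u (volume.restrict Ω) ∧
      ∀ᵐ x ∂(volume.restrict Ω), Tendsto (fun k => φ (σ k) x) atTop (𝓝 (u x)) := by
  set μ : Measure (Rn N) := volume.restrict Ω with hμ
  have : IsFiniteMeasure μ := ⟨by simpa [hμ] using hb.measure_lt_top⟩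
  have hc : ∀ k, Continuous (φ k) := fun k => (hφ k).smooth.continuous
  have hC1 : ∀ k, ContDiff ℝ 1 (φ k) := fun k => (hφ k).smooth.of_le (by norm_cast)
  obtain ⟨σ, hσ, hlim⟩ := exists_subseq_tendsto_setIntegral (μ := μ)
    (fun k => (hc k).aestronglyMeasurable) hB
  have hball : ∀ k x r, ∫ y in Metric.ball x r, φ k y ∂μ = ∫ h in Metric.ball 0 r, φ k (x + h) := by
    intro k x r
    rw [hμ, Measure.restrict_restrict measurableSet_ball, ← setIntegral_eq_of_subset_of_forall_sdiff_eq_zero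
      (measurableSet_ball) Set.inter_subset_left
      (fun y hy => (hφ k).eq_zero_of_notMem fun hy' => hy.2 ⟨hy.1, hy'⟩)]
    have hmp := (measurePreserving_add_left (volume : Measure (Rn N)) x).setIntegral_preimage_emb
      (measurableEmbedding_addLeft x) (φ k) (Metric.ball x r)
    rw [← hmp]
    congr 2
    ext y
    simp
  have hcauchy : ∀ ε : ℝ≥0∞, 0 < ε → ε ≠ ⊤ → ∃ k₀, ∀ k ≥ k₀, ∀ l ≥ k₀,
      ∫⁻ x, ‖φ (σ k) x - φ (σ l) x‖ₑ ∂μ ≤ ε := by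
    intro ε hε hεt
    -- a radius `r` with `2 r G ≤ ε / 2`
    obtain ⟨r, hr, hrG⟩ : ∃ r : ℝ, 0 < r ∧ 2 * (ENNReal.ofReal r * G) ≤ ε / 2 := by
      refine ⟨ε.toReal / (4 * (G.toReal + 1)), ?_, ?_⟩
      · have := ENNReal.toReal_pos hε.ne' hεt
        positivity
      · have hε0 := ENNReal.toReal_pos hε.ne' hεt
        rw [← ENNReal.ofReal_toReal hG, ← ENNReal.ofReal_toReal hεt,
          ← ENNReal.ofReal_mul (by positivity), ENNReal.toReal_ofReal ENNReal.toReal_nonneg,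
          ENNReal.toReal_ofReal ENNReal.toReal_nonneg,
          show (2 : ℝ≥0∞) = ENNReal.ofReal 2 by simp, ← ENNReal.ofReal_mul (by positivity),
          ← ENNReal.ofReal_div_of_pos (by norm_num)]
        apply ENNReal.ofReal_le_ofReal
        have hg : 0 ≤ G.toReal := ENNReal.toReal_nonneg
        rw [← sub_nonneg]
        have : ε.toReal / 2 - 2 * (ε.toReal / (4 * (G.toReal + 1)) * G.toReal)
          = ε.toReal / (2 * (G.toReal + 1)) := by field_simp; ring
        rw [this]
        positivity
    set V : ℝ≥0∞ := (volume : Measure (Rn N)) (Metric.ball 0 r) with hV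
    have hV0 : V ≠ 0 := (Metric.measure_ball_pos _ _ hr).ne'
    have hVt : V ≠ ⊤ := measure_ball_lt_top.ne
    set A : ℕ → Rn N → ℝ := fun k x => ∫ y in Metric.ball x r, φ k y ∂μ with hA
    choose b hbl using fun x : Rn N => hlim (Metric.ball x r) measurableSet_ball
    have hAc : ∀ k, AEStronglyMeasurable (A k) μ := by
      intro k
      have : A k = fun x => ∫ h in Metric.ball 0 r, φ k (x + h) := funext fun x => hball k x r
      rw [this]
      have hj : StronglyMeasurable (Function.uncurry fun (x h : Rn N) => φ k (x + h)) := by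
        have : Continuous (Function.uncurry fun (x h : Rn N) => φ k (x + h)) := by
          have := hc k
          fun_prop
        exact this.stronglyMeasurable
      exact (hj.integral_prod_right (ν := volume.restrict (Metric.ball 0 r))).aestronglyMeasurable
    have hAb : ∀ k x, ‖A k x‖ ≤ B * (μ Set.univ).toReal := by
      intro k x
      have h0 : 0 ≤ B := (norm_nonneg _).trans (hB k x)
      refine (norm_setIntegral_le_of_norm_le_const (measure_lt_top _ _) fun y _ => hB k y).trans ?_
      exact mul_le_mul_of_nonneg_left (measureReal_mono (Set.subset_univ _)) h0
    have hA1 : Tendsto (fun k => ∫⁻ x, ENNReal.ofReal ‖A (σ k) x - b x‖ ∂μ) atTop (𝓝 0) :=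
      tendsto_lintegral_norm_of_dominated_convergence (fun k => hAc (σ k))
        (bound := fun _ => B * (μ Set.univ).toReal)
        (hasFiniteIntegral_const _) (fun k => Eventually.of_forall (hAb (σ k)))
        (Eventually.of_forall hbl)
    have hbm : AEStronglyMeasurable b μ :=
      aestronglyMeasurable_of_tendsto_ae atTop (fun k => hAc (σ k)) (Eventually.of_forall hbl)
    have hε4 : 0 < V * (ε / 4) := by
      refine pos_iff_ne_zero.2 (mul_ne_zero hV0 ?_)
      exact (ENNReal.div_pos hε.ne' (by simp)).ne'
    obtain ⟨k₀, hk₀⟩ := eventually_atTop.1 (hA1.eventually (gt_mem_nhds hε4))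
    refine ⟨k₀, fun k hk l hl => ?_⟩
    have hclose : ∀ k, ∫⁻ x, ‖V.toReal * φ k x - A k x‖ₑ ∂μ ≤ V * (ENNReal.ofReal r * G) := by
      intro k
      have h1 := lintegral_enorm_sub_integral_ball_le (μ := (volume : Measure (Rn N))) (hC1 k) r
      calc _ ≤ ∫⁻ x, ‖V.toReal * φ k x - A k x‖ₑ := lintegral_mono' Measure.restrict_le_self le_rfl
        _ = ∫⁻ x, ‖V.toReal * φ k x - ∫ h in Metric.ball 0 r, φ k (x + h)‖ₑ := by
            simp only [hA, hball]
        _ ≤ _ := h1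
        _ ≤ _ := by gcongr; exact hφG k
    have hmA : ∀ k, AEMeasurable (fun x => ‖V.toReal * φ k x - A k x‖ₑ) μ := fun k =>
      (((hc k).aestronglyMeasurable.const_mul _).sub (hAc k)).enorm
    have hmb : ∀ k, AEMeasurable (fun x => ‖A k x - b x‖ₑ) μ := fun k => ((hAc k).sub hbm).enorm
    have hmain : V * ∫⁻ x, ‖φ (σ k) x - φ (σ l) x‖ₑ ∂μ ≤ V * ε := by
      rw [← lintegral_const_mul' _ _ hVt]
      calc ∫⁻ x, V * ‖φ (σ k) x - φ (σ l) x‖ₑ ∂μ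
          ≤ ∫⁻ x, ((‖V.toReal * φ (σ k) x - A (σ k) x‖ₑ + ‖V.toReal * φ (σ l) x - A (σ l) x‖ₑ)
            + (‖A (σ k) x - b x‖ₑ + ‖A (σ l) x - b x‖ₑ)) ∂μ := by
            refine lintegral_mono fun x => ?_
            have e1 : V * ‖φ (σ k) x - φ (σ l) x‖ₑ
                = ‖V.toReal * φ (σ k) x - V.toReal * φ (σ l) x‖ₑ := by
              rw [← mul_sub, enorm_mul, Real.enorm_of_nonneg ENNReal.toReal_nonneg,
                ENNReal.ofReal_toReal hVt]
            have e2 : V.toReal * φ (σ k) x - V.toReal * φ (σ l) x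
              = ((V.toReal * φ (σ k) x - A (σ k) x) - (V.toReal * φ (σ l) x - A (σ l) x))
                + ((A (σ k) x - b x) - (A (σ l) x - b x)) := by ring
            rw [e1, e2]
            exact (enorm_add_le _ _).trans (add_le_add enorm_sub_le enorm_sub_le)
        _ = (∫⁻ x, ‖V.toReal * φ (σ k) x - A (σ k) x‖ₑ ∂μ
              + ∫⁻ x, ‖V.toReal * φ (σ l) x - A (σ l) x‖ₑ ∂μ)
            + (∫⁻ x, ‖A (σ k) x - b x‖ₑ ∂μ + ∫⁻ x, ‖A (σ l) x - b x‖ₑ ∂μ) := by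
            have hmm : AEMeasurable (fun x => ‖V.toReal * φ (σ k) x - A (σ k) x‖ₑ
              + ‖V.toReal * φ (σ l) x - A (σ l) x‖ₑ) μ := (hmA _).add (hmA _)
            rw [lintegral_add_left' hmm, lintegral_add_left' (hmA _), lintegral_add_left' (hmb _)]
        _ ≤ (V * (ENNReal.ofReal r * G) + V * (ENNReal.ofReal r * G))
            + (V * (ε / 4) + V * (ε / 4)) := by
            have hk1 := (hk₀ k hk).le
            have hl1 := (hk₀ l hl).le
            simp only [ofReal_norm] at hk1 hl1
            gcongr
            · exact hclose _
            · exact hclose _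
        _ = V * (2 * (ENNReal.ofReal r * G) + 2 * (ε / 4)) := by ring
        _ ≤ V * (ε / 2 + ε / 2) := by
            gcongr
            rw [ENNReal.div_eq_inv_mul, ENNReal.div_eq_inv_mul, ← mul_assoc]
            gcongr
            rw [show (4 : ℝ≥0∞) = 2 * 2 by norm_num, ENNReal.mul_inv (by simp) (by simp),
              ← mul_assoc, ENNReal.mul_inv_cancel (by simp) (by simp), one_mul]
        _ = V * ε := by rw [ENNReal.add_halves]
    exact (ENNReal.mul_le_mul_iff_right hV0 hVt).1 hmain
  have hmem : ∀ k, MemLp (φ k) 1 μ := fun k =>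
    MemLp.of_bound (hc k).aestronglyMeasurable B (Eventually.of_forall (hB k))
  have hCS : CauchySeq fun k => (hmem (σ k)).toLp (φ (σ k)) := by
    rw [EMetric.cauchySeq_iff']
    intro ε hε
    obtain ⟨δ, hδ0, hδ⟩ := exists_between hε
    obtain ⟨k₀, hk₀⟩ := hcauchy δ hδ0 hδ.ne_top
    refine ⟨k₀, fun k hk => ?_⟩
    rw [Lp.edist_toLp_toLp, eLpNorm_one_eq_lintegral_enorm]
    exact (hk₀ k hk k₀ le_rfl).trans_lt hδ
  obtain ⟨u, hu⟩ := cauchySeq_tendsto_of_complete hCS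
  have hmeas := tendstoInMeasure_of_tendsto_Lp hu
  obtain ⟨τ, hτ, hae⟩ := hmeas.exists_seq_tendsto_ae
  refine ⟨σ ∘ τ, hσ.comp hτ, u, (Lp.aestronglyMeasurable u), ?_⟩
  have hall : ∀ᵐ x ∂μ, ∀ k, (hmem (σ (τ k))).toLp (φ (σ (τ k))) x = φ (σ (τ k)) x :=
    ae_all_iff.2 fun k => (hmem (σ (τ k))).coeFn_toLp
  filter_upwards [hae, hall] with x h1 h2
  exact h1.congr fun k => h2 k

end Compactness

/-! ### The space `W₀^{1,p}` -/

section Sobolev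

variable {N : ℕ} {Ω : Set (Rn N)} {p : ℝ} {φ ψ : Rn N → ℝ}

namespace IsTestFunction

theorem differentiable (h : IsTestFunction Ω φ) : Differentiable ℝ φ :=
  h.smooth.differentiable (by simp)

theorem continuous_fderiv (h : IsTestFunction Ω φ) : Continuous (fderiv ℝ φ) :=
  h.smooth.continuous_fderiv (by simp)

theorem continuous_gradient (h : IsTestFunction Ω φ) : Continuous (gradient φ) :=
  (InnerProductSpace.toDual ℝ (Rn N)).symm.continuous.comp h.continuous_fderiv

theorem hasCompactSupport_gradient (h : IsTestFunction Ω φ) : HasCompactSupport (gradient φ) :=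
  (h.compact_support.fderiv (𝕜 := ℝ)).comp_left
    (g := (InnerProductSpace.toDual ℝ (Rn N)).symm) (map_zero _)

theorem gradient_eq_zero_of_notMem (h : IsTestFunction Ω φ) {x : Rn N} (hx : x ∉ Ω) :
    gradient φ x = 0 := by
  have : fderiv ℝ φ x = 0 := fderiv_of_notMem_tsupport ℝ fun hx' => hx (h.support_subset hx')
  rw [gradient, this, map_zero]

theorem memLp (h : IsTestFunction Ω φ) (q : ℝ≥0∞) : MemLp φ q (volume.restrict Ω) :=
  (h.smooth.continuous.memLp_of_hasCompactSupport h.compact_support).restrict Ω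

theorem memLp_gradient (h : IsTestFunction Ω φ) (q : ℝ≥0∞) :
    MemLp (gradient φ) q (volume.restrict Ω) :=
  (h.continuous_gradient.memLp_of_hasCompactSupport h.hasCompactSupport_gradient).restrict Ω

theorem add_mul (hφ : IsTestFunction Ω φ) (hψ : IsTestFunction Ω ψ) (t : ℝ) :
    IsTestFunction Ω (fun x => φ x + t * ψ x) where
  smooth := hφ.smooth.add (contDiff_const.mul hψ.smooth)
  compact_support := hφ.compact_support.add hψ.compact_support.mul_left
  support_subset := by
    refine (tsupport_add φ fun x => t * ψ x).trans (Set.union_subset hφ.support_subset ?_)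
    exact (tsupport_mul_subset_right (f := fun _ => t) (g := ψ)).trans hψ.support_subset

theorem const_mul (hψ : IsTestFunction Ω ψ) (t : ℝ) : IsTestFunction Ω (fun x => t * ψ x) where
  smooth := contDiff_const.mul hψ.smooth
  compact_support := hψ.compact_support.mul_left
  support_subset :=
    (tsupport_mul_subset_right (f := fun _ => t) (g := ψ)).trans hψ.support_subset

theorem hasGradientAt (h : IsTestFunction Ω φ) (x : Rn N) :
    HasGradientAt φ (gradient φ x) x := (h.differentiable x).hasGradientAt

theorem gradient_const_mul (hψ : IsTestFunction Ω ψ) (t : ℝ) (x : Rn N) :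
    gradient (fun x => t * ψ x) x = t • gradient ψ x := by
  refine HasGradientAt.gradient ?_
  have := (hψ.hasGradientAt x).hasFDerivAt.const_mul t
  rw [hasGradientAt_iff_hasFDerivAt]
  simpa using this

theorem gradient_add_mul (hφ : IsTestFunction Ω φ) (hψ : IsTestFunction Ω ψ) (t : ℝ) (x : Rn N) :
    gradient (fun x => φ x + t * ψ x) x = gradient φ x + t • gradient ψ x := by
  refine HasGradientAt.gradient ?_
  have := (hφ.hasGradientAt x).hasFDerivAt.add ((hψ.hasGradientAt x).hasFDerivAt.const_mul t)
  rw [hasGradientAt_iff_hasFDerivAt, map_add, map_smul]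
  exact this

theorem integral_smul_gradient (hφ : IsTestFunction Ω φ) (hψ : IsTestFunction Ω ψ) :
    ∫ x in Ω, φ x • gradient ψ x = - ∫ x in Ω, ψ x • gradient φ x := by
  have e1 : ∫ x in Ω, φ x • gradient ψ x = ∫ x, φ x • gradient ψ x :=
    setIntegral_eq_integral_of_forall_compl_eq_zero fun x hx => by
      rw [hφ.eq_zero_of_notMem hx, zero_smul]
  have e2 : ∫ x in Ω, ψ x • gradient φ x = ∫ x, ψ x • gradient φ x :=
    setIntegral_eq_integral_of_forall_compl_eq_zero fun x hx => by
      rw [hψ.eq_zero_of_notMem hx, zero_smul]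
  have i1 : Integrable fun x => φ x • gradient ψ x :=
    (hφ.smooth.continuous.smul hψ.continuous_gradient).integrable_of_hasCompactSupport
      hφ.compact_support.smul_right
  have i2 : Integrable fun x => ψ x • gradient φ x :=
    (hψ.smooth.continuous.smul hφ.continuous_gradient).integrable_of_hasCompactSupport
      hψ.compact_support.smul_right
  rw [e1, e2]
  refine ext_inner_left ℝ fun v => ?_
  rw [inner_neg_right, ← integral_inner i1, ← integral_inner i2]
  have hv : ∀ (w : Rn N → ℝ) x, inner ℝ v (gradient w x) = fderiv ℝ w x v := fun w x => by
    rw [inner_gradient_right]; simp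
  simp_rw [inner_smul_right, hv]
  have hcφ : Continuous fun x => fderiv ℝ φ x v := hφ.continuous_fderiv.clm_apply continuous_const
  have hcψ : Continuous fun x => fderiv ℝ ψ x v := hψ.continuous_fderiv.clm_apply continuous_const
  rw [integral_mul_fderiv_eq_neg_fderiv_mul_of_integrable]
  · simp_rw [mul_comm]
  · exact (hcφ.mul hψ.smooth.continuous).integrable_of_hasCompactSupport
      hψ.compact_support.mul_left
  · exact (hφ.smooth.continuous.mul hcψ).integrable_of_hasCompactSupport
      hφ.compact_support.mul_right
  · exact (hφ.smooth.continuous.mul hψ.smooth.continuous).integrable_of_hasCompactSupport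
      hφ.compact_support.mul_right
  · exact fun x _ => hφ.differentiable x
  · exact fun x _ => hψ.differentiable x

end IsTestFunction

theorem tendsto_eLpNorm_one {X E : Type*} [MeasurableSpace X] {μ : Measure X}
    [IsFiniteMeasure μ] [NormedAddCommGroup E] (hp : 1 < p)
    {w : ℕ → X → E} {w' : X → E} (hw : ∀ k, MemLp (w k) (ENNReal.ofReal p) μ)
    (hw' : MemLp w' (ENNReal.ofReal p) μ)
    (hlim : Tendsto (fun k => eLpNorm (fun x => w' x - w k x) (ENNReal.ofReal p) μ) atTop (𝓝 0)) :
    Tendsto (fun k => eLpNorm (fun x => w' x - w k x) 1 μ) atTop (𝓝 0) := by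
  have h1p : (1 : ℝ≥0∞) ≤ ENNReal.ofReal p := ENNReal.one_le_ofReal.2 hp.le
  have hc : Tendsto (fun k => eLpNorm (fun x => w' x - w k x) (ENNReal.ofReal p) μ
      * μ Set.univ ^ (1 / (1 : ℝ≥0∞).toReal - 1 / (ENNReal.ofReal p).toReal)) atTop (𝓝 0) := by
    have := ENNReal.Tendsto.mul_const hlim (b := μ Set.univ ^ (1 / (1 : ℝ≥0∞).toReal - 1 /
      (ENNReal.ofReal p).toReal)) (Or.inr (ENNReal.rpow_ne_top_of_nonneg (by
        rw [ENNReal.toReal_ofReal (by linarith)]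
        simp
        exact inv_le_one_of_one_le₀ hp.le) (measure_ne_top _ _)))
    simpa using this
  refine tendsto_of_tendsto_of_tendsto_of_le_of_le tendsto_const_nhds hc (fun _ => bot_le)
    fun k => ?_
  exact eLpNorm_le_eLpNorm_mul_rpow_measure_univ h1p (hw'.sub (hw k)).1

theorem tendsto_integral_clm_of_tendsto_eLpNorm {X E : Type*} [MeasurableSpace X] {μ : Measure X}
    [IsFiniteMeasure μ] [NormedAddCommGroup E] [NormedSpace ℝ E] (hp : 1 < p)
    {w : ℕ → X → E} {w' : X → E} (hw : ∀ k, MemLp (w k) (ENNReal.ofReal p) μ)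
    (hw' : MemLp w' (ENNReal.ofReal p) μ)
    (hlim : Tendsto (fun k => eLpNorm (fun x => w' x - w k x) (ENNReal.ofReal p) μ) atTop (𝓝 0))
    {F : Type*} [NormedAddCommGroup F] [NormedSpace ℝ F]
    (L : X → E →L[ℝ] F) (hL : AEStronglyMeasurable L μ) {B : ℝ} (hB : ∀ x, ‖L x‖ ≤ B) :
    Tendsto (fun k => ∫ x, L x (w k x) ∂μ) atTop (𝓝 (∫ x, L x (w' x) ∂μ)) := by
  have h1p : (1 : ℝ≥0∞) ≤ ENNReal.ofReal p := ENNReal.one_le_ofReal.2 hp.le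
  have happ : ∀ {g : X → E}, MemLp g (ENNReal.ofReal p) μ → Integrable (fun x => L x (g x)) μ := by
    intro g hg
    have hgi := hg.integrable h1p
    refine (hgi.norm.const_mul B).mono' ?_ (Eventually.of_forall fun x => ?_)
    · exact isBoundedBilinearMap_apply.continuous.comp_aestronglyMeasurable₂ hL hg.1
    · exact ((L x).le_opNorm _).trans (by gcongr; exact hB x)
  have hl1 := tendsto_eLpNorm_one hp hw hw' hlim
  refine tendsto_integral_of_L1 _ (happ hw').1 (Eventually.of_forall fun k => happ (hw k)) ?_
  have h2 : Tendsto (fun k => ENNReal.ofReal B * eLpNorm (fun x => w' x - w k x) 1 μ)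
      atTop (𝓝 0) := by
    simpa using ENNReal.Tendsto.const_mul hl1 (a := ENNReal.ofReal B) (Or.inr ENNReal.ofReal_ne_top)
  refine tendsto_of_tendsto_of_tendsto_of_le_of_le tendsto_const_nhds h2 (fun _ => bot_le)
    fun k => ?_
  simp only
  rw [eLpNorm_one_eq_lintegral_enorm, ← lintegral_const_mul' _ _ ENNReal.ofReal_ne_top]
  refine lintegral_mono fun x => ?_
  rw [← map_sub, ← enorm_neg, ← map_neg, neg_sub]
  refine ((L x).le_opENorm _).trans ?_
  gcongr
  rw [← ofReal_norm]
  exact ENNReal.ofReal_le_ofReal (hB x)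

/-- `L^p` limits of test functions whose gradients converge in `L^p` lie in `W₀^{1,p}`: the
integration by parts formula passes to the limit. -/
theorem MemW1p0.of_tendsto [IsFiniteMeasure (volume.restrict Ω)] (hp : 1 < p)
    {u : Rn N → ℝ} {g : Rn N → Rn N} (hu : MemLp u (ENNReal.ofReal p) (volume.restrict Ω))
    (hg : MemLp g (ENNReal.ofReal p) (volume.restrict Ω)) {φ : ℕ → Rn N → ℝ}
    (hφ : ∀ k, IsTestFunction Ω (φ k))
    (h1 : Tendsto (fun k => eLpNorm (fun x => u x - φ k x) (ENNReal.ofReal p) (volume.restrict Ω))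
      atTop (𝓝 0))
    (h2 : Tendsto (fun k => eLpNorm (fun x => g x - gradient (φ k) x) (ENNReal.ofReal p)
      (volume.restrict Ω)) atTop (𝓝 0)) : MemW1p0 Ω p u g := by
  have h1p : (1 : ℝ≥0∞) ≤ ENNReal.ofReal p := ENNReal.one_le_ofReal.2 hp.le
  refine ⟨⟨hu, hg, ?_, ?_, fun ψ hψ => ?_⟩, φ, hφ, h1, h2⟩
  · exact IntegrableOn.locallyIntegrableOn (hu.integrable h1p)
  · exact IntegrableOn.locallyIntegrableOn (hg.integrable h1p)
  obtain ⟨B₁, hB₁⟩ := hψ.continuous_gradient.bounded_above_of_compact_support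
    hψ.hasCompactSupport_gradient
  obtain ⟨B₂, hB₂⟩ := hψ.smooth.continuous.bounded_above_of_compact_support hψ.compact_support
  have l1 := tendsto_integral_clm_of_tendsto_eLpNorm hp (fun k => (hφ k).memLp _) hu h1
    (fun x => (ContinuousLinearMap.lsmul ℝ ℝ (E := Rn N)).flip (gradient ψ x))
    ((ContinuousLinearMap.lsmul ℝ ℝ).flip.continuous.comp
      hψ.continuous_gradient).aestronglyMeasurable
    (fun x => ContinuousLinearMap.opNorm_le_bound _ ((norm_nonneg _).trans (hB₁ x)) fun t => by
      rw [ContinuousLinearMap.flip_apply, ContinuousLinearMap.lsmul_apply, norm_smul, mul_comm]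
      gcongr
      exact hB₁ x)
  have l2 := tendsto_integral_clm_of_tendsto_eLpNorm hp (fun k => (hφ k).memLp_gradient _) hg h2
    (fun x => ψ x • ContinuousLinearMap.id ℝ (Rn N))
    (hψ.smooth.continuous.smul continuous_const).aestronglyMeasurable
    (B := B₂) (fun x => by
      rw [norm_smul]
      exact (mul_le_of_le_one_right (norm_nonneg _) ContinuousLinearMap.norm_id_le).trans (hB₂ x))
  simp only [ContinuousLinearMap.flip_apply, ContinuousLinearMap.lsmul_apply, smul_apply,
    ContinuousLinearMap.id_apply] at l1 l2
  refine tendsto_nhds_unique l1 ?_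
  have l3 := l2.neg
  refine l3.congr fun k => ?_
  exact ((hφ k).integral_smul_gradient hψ).symm

theorem exists_isTestFunction_eLpNorm_lt {u : Rn N → ℝ} {g : Rn N → Rn N} (h : MemW1p0 Ω p u g)
    {ε : ℝ≥0∞} (hε : 0 < ε) : ∃ φ, IsTestFunction Ω φ ∧
      eLpNorm (fun x => u x - φ x) (ENNReal.ofReal p) (volume.restrict Ω) < ε ∧
      eLpNorm (fun x => g x - gradient φ x) (ENNReal.ofReal p) (volume.restrict Ω) < ε := by
  obtain ⟨φ, hφ, h1, h2⟩ := h.approx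
  obtain ⟨k, hk1, hk2⟩ := ((h1.eventually (gt_mem_nhds hε)).and
    (h2.eventually (gt_mem_nhds hε))).exists
  exact ⟨φ k, hφ k, hk1, hk2⟩

variable [IsFiniteMeasure (volume.restrict Ω)]

theorem IsTestFunction.memW1p0 (hφ : IsTestFunction Ω φ) (hp : 1 < p) :
    MemW1p0 Ω p φ (gradient φ) :=
  MemW1p0.of_tendsto hp (hφ.memLp _) (hφ.memLp_gradient _) (fun _ => hφ) (by simp) (by simp)

namespace MemW1p0

theorem of_tendsto_memW1p0 (hp : 1 < p) {u : Rn N → ℝ} {g : Rn N → Rn N}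
    (hu : MemLp u (ENNReal.ofReal p) (volume.restrict Ω))
    (hg : MemLp g (ENNReal.ofReal p) (volume.restrict Ω)) {v : ℕ → Rn N → ℝ}
    {h : ℕ → Rn N → Rn N} (hv : ∀ k, MemW1p0 Ω p (v k) (h k))
    (h1 : Tendsto (fun k => eLpNorm (fun x => u x - v k x) (ENNReal.ofReal p) (volume.restrict Ω))
      atTop (𝓝 0))
    (h2 : Tendsto (fun k => eLpNorm (fun x => g x - h k x) (ENNReal.ofReal p)
      (volume.restrict Ω)) atTop (𝓝 0)) : MemW1p0 Ω p u g := by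
  have h1p : (1 : ℝ≥0∞) ≤ ENNReal.ofReal p := ENNReal.one_le_ofReal.2 hp.le
  have hε : ∀ k : ℕ, (0 : ℝ≥0∞) < (k + 1 : ℝ≥0∞)⁻¹ := fun k =>
    ENNReal.inv_pos.2 (by finiteness)
  choose φ hφ hφ1 hφ2 using fun k => exists_isTestFunction_eLpNorm_lt (hv k) (hε k)
  have hinv : Tendsto (fun k : ℕ => (k + 1 : ℝ≥0∞)⁻¹) atTop (𝓝 0) := by
    have := (tendsto_add_atTop_iff_nat 1).2 ENNReal.tendsto_inv_nat_nhds_zero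
    simpa using this
  refine MemW1p0.of_tendsto hp hu hg hφ ?_ ?_
  · refine tendsto_of_tendsto_of_tendsto_of_le_of_le tendsto_const_nhds
      (by simpa using h1.add hinv) (fun _ => bot_le) fun k => ?_
    refine le_trans ?_ (add_le_add le_rfl (hφ1 k).le)
    have := eLpNorm_add_le (hu.sub (hv k).memW1p.memLp).1
      ((hv k).memW1p.memLp.sub ((hφ k).memLp _)).1 h1p
    rw [show (u - v k) + (v k - φ k) = fun x => u x - φ k x by ext; simp] at this
    exact this
  · refine tendsto_of_tendsto_of_tendsto_of_le_of_le tendsto_const_nhds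
      (by simpa using h2.add hinv) (fun _ => bot_le) fun k => ?_
    refine le_trans ?_ (add_le_add le_rfl (hφ2 k).le)
    have := eLpNorm_add_le (hg.sub (hv k).memW1p.memLp_grad).1
      ((hv k).memW1p.memLp_grad.sub ((hφ k).memLp_gradient _)).1 h1p
    rw [show (g - h k) + (h k - gradient (φ k)) = fun x => g x - gradient (φ k) x by
      ext; simp] at this
    exact this

variable {u v : Rn N → ℝ} {g h : Rn N → Rn N}

theorem const_mul (hp : 1 < p) (hu : MemW1p0 Ω p u g) (t : ℝ) :
    MemW1p0 Ω p (fun x => t * u x) (fun x => t • g x) := by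
  obtain ⟨φ, hφ, h1, h2⟩ := hu.approx
  refine of_tendsto hp (hu.memW1p.memLp.const_mul t) (hu.memW1p.memLp_grad.const_smul t)
    (fun k => (hφ k).const_mul t) ?_ ?_
  · have := ENNReal.Tendsto.const_mul h1 (a := ‖t‖ₑ) (Or.inr enorm_ne_top)
    rw [mul_zero] at this
    refine this.congr fun k => ?_
    rw [← eLpNorm_const_smul]
    congr 1
    ext x
    simp [mul_sub]
  · have := ENNReal.Tendsto.const_mul h2 (a := ‖t‖ₑ) (Or.inr enorm_ne_top)
    rw [mul_zero] at this
    refine this.congr fun k => ?_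
    rw [← eLpNorm_const_smul]
    congr 1
    ext1 x
    rw [(hφ k).gradient_const_mul, Pi.smul_apply, smul_sub]

theorem add_mul (hp : 1 < p) (hu : MemW1p0 Ω p u g) (hv : MemW1p0 Ω p v h) (t : ℝ) :
    MemW1p0 Ω p (fun x => u x + t * v x) (fun x => g x + t • h x) := by
  have h1p : (1 : ℝ≥0∞) ≤ ENNReal.ofReal p := ENNReal.one_le_ofReal.2 hp.le
  have hv' := hv.const_mul hp t
  obtain ⟨φ, hφ, h1, h2⟩ := hu.approx
  obtain ⟨ψ, hψ, h3, h4⟩ := hv'.approx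
  have hgr : ∀ k x, gradient (fun x => φ k x + 1 * ψ k x) x = gradient (φ k) x + gradient (ψ k) x :=
    fun k x => by rw [(hφ k).gradient_add_mul (hψ k), one_smul]
  refine of_tendsto hp (hu.memW1p.memLp.add hv'.memW1p.memLp)
    (hu.memW1p.memLp_grad.add hv'.memW1p.memLp_grad)
    (fun k => (hφ k).add_mul (hψ k) 1) ?_ ?_
  · refine tendsto_of_tendsto_of_tendsto_of_le_of_le tendsto_const_nhds
      (by simpa using h1.add h3) (fun _ => bot_le) fun k => ?_
    refine le_trans (le_of_eq ?_) (eLpNorm_add_le (hu.memW1p.memLp.sub ((hφ k).memLp _)).1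
      (hv'.memW1p.memLp.sub ((hψ k).memLp _)).1 h1p)
    congr 1
    ext x
    simp only [Pi.add_apply]
    ring
  · refine tendsto_of_tendsto_of_tendsto_of_le_of_le tendsto_const_nhds
      (by simpa using h2.add h4) (fun _ => bot_le) fun k => ?_
    refine le_trans (le_of_eq ?_) (eLpNorm_add_le
      (hu.memW1p.memLp_grad.sub ((hφ k).memLp_gradient _)).1
      (hv'.memW1p.memLp_grad.sub ((hψ k).memLp_gradient _)).1 h1p)
    congr 1
    ext1 x
    rw [hgr]
    simp only [Pi.add_apply]
    abel

end MemW1p0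

end Sobolev

/-! ### Truncation -/

section Truncation

/-- The projection of `ℝ` onto `[0, s]`, for `0 ≤ s`. -/
noncomputable def clamp (s t : ℝ) : ℝ := max 0 (min s t)

theorem continuous_clamp (s : ℝ) : Continuous (clamp s) := by
  unfold clamp; fun_prop

theorem clamp_nonneg (s t : ℝ) : 0 ≤ clamp s t := le_max_left _ _

theorem clamp_le {s : ℝ} (hs : 0 ≤ s) (t : ℝ) : clamp s t ≤ s := max_le hs (min_le_left _ _)

theorem clamp_of_mem {s t : ℝ} (h0 : 0 ≤ t) (hs : t ≤ s) : clamp s t = t := by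
  rw [clamp, min_eq_right hs, max_eq_right h0]

theorem clamp_of_nonpos {s t : ℝ} (ht : t ≤ 0) : clamp s t = 0 :=
  max_eq_left ((min_le_right _ _).trans ht)

theorem clamp_of_ge {s t : ℝ} (hs : 0 ≤ s) (ht : s ≤ t) : clamp s t = s := by
  rw [clamp, min_eq_left ht, max_eq_right hs]

/-- A smooth nondecreasing `1`-Lipschitz function vanishing at `0` and uniformly `δ`-close to the
truncation at levels `0` and `s`: a primitive of a bump function equal to `1` on `[0, s]`. -/
theorem exists_smooth_clamp {s δ : ℝ} (hs : 0 < s) (hδ : 0 < δ) :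
    ∃ T : ℝ → ℝ, ContDiff ℝ ∞ T ∧ T 0 = 0 ∧ (∀ t, 0 ≤ deriv T t ∧ deriv T t ≤ 1) ∧
      ∀ t, |T t - clamp s t| ≤ δ := by
  let χ : ContDiffBump (s / 2 : ℝ) := ⟨s / 2, s / 2 + δ, by positivity, by linarith⟩
  have hχc : Continuous χ := χ.continuous
  have hi : ∀ a b : ℝ, IntervalIntegrable χ volume a b := fun a b => hχc.intervalIntegrable a b
  set T : ℝ → ℝ := fun t => ∫ r in (0 : ℝ)..t, χ r with hT
  have hTd : ∀ t, HasDerivAt T (χ t) t := fun t =>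
    intervalIntegral.integral_hasDerivAt_right (hi 0 t)
      (hχc.stronglyMeasurableAtFilter _ _) hχc.continuousAt
  have hderiv : deriv T = χ := funext fun t => (hTd t).deriv
  have hone : ∀ r ∈ Set.Icc 0 s, χ r = 1 := by
    intro r hr
    apply χ.one_of_mem_closedBall
    rw [Metric.mem_closedBall, Real.dist_eq, abs_le]
    constructor <;> simp only [χ] <;> linarith [hr.1, hr.2]
  have hzero : ∀ r, s + δ ≤ r ∨ r ≤ -δ → χ r = 0 := by
    intro r hr
    apply χ.zero_of_le_dist
    rw [Real.dist_eq, le_abs]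
    simp only [χ]
    rcases hr with hr | hr
    · left; linarith
    · right; linarith
  have hnn : ∀ a b, a ≤ b → 0 ≤ ∫ r in a..b, χ r := fun a b hab =>
    intervalIntegral.integral_nonneg hab fun r _ => χ.nonneg
  have hle : ∀ a b, a ≤ b → ∫ r in a..b, χ r ≤ b - a := by
    intro a b hab
    have := intervalIntegral.integral_mono_on hab (hi a b)
      (intervalIntegrable_const (c := (1 : ℝ))) fun r _ => χ.le_one
    simpa using this
  have hTs : ∀ t ∈ Set.Icc 0 s, T t = t := by
    intro t ht
    have : ∫ r in (0 : ℝ)..t, χ r = ∫ _ in (0 : ℝ)..t, (1 : ℝ) := by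
      refine intervalIntegral.integral_congr fun r hr => ?_
      rw [Set.uIcc_of_le ht.1] at hr
      exact hone r ⟨hr.1, hr.2.trans ht.2⟩
    simp only [hT, this]
    simp
  refine ⟨T, ?_, by simp [hT], fun t => by rw [hderiv]; exact ⟨χ.nonneg, χ.le_one⟩, fun t => ?_⟩
  · rw [contDiff_infty_iff_deriv, hderiv]
    exact ⟨fun t => (hTd t).differentiableAt, χ.contDiff⟩
  · rcases le_total t 0 with h0 | h0
    · rw [clamp_of_nonpos h0, sub_zero, abs_le]
      have e : T t = -∫ r in t..0, χ r := by
        simp only [hT]; rw [intervalIntegral.integral_symm]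
      rw [e]
      refine ⟨neg_le_neg ?_, (neg_nonpos.2 (hnn t 0 h0)).trans hδ.le⟩
      rcases le_total (-δ) t with h1 | h1
      · linarith [hle t 0 h0]
      · rw [← intervalIntegral.integral_add_adjacent_intervals (hi t (-δ)) (hi (-δ) 0)]
        have : ∫ r in t..-δ, χ r = 0 := by
          rw [intervalIntegral.integral_congr (g := fun _ => (0 : ℝ)), intervalIntegral.integral_zero]
          intro r hr
          rw [Set.uIcc_of_le h1] at hr
          exact hzero r (Or.inr hr.2)
        linarith [hle (-δ) 0 (by linarith)]
    · rcases le_total t s with h1 | h1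
      · rw [clamp_of_mem h0 h1, hTs t ⟨h0, h1⟩]
        simpa using hδ.le
      · rw [clamp_of_ge hs.le h1]
        have e : T t - s = ∫ r in s..t, χ r := by
          have h2 := hTs s ⟨hs.le, le_rfl⟩
          simp only [hT] at h2 ⊢
          rw [← intervalIntegral.integral_add_adjacent_intervals (hi 0 s) (hi s t), h2]
          ring
        rw [e, abs_le]
        refine ⟨by linarith [hnn s t h1], ?_⟩
        rcases le_total t (s + δ) with h2 | h2
        · linarith [hle s t h1]
        · rw [← intervalIntegral.integral_add_adjacent_intervals (hi s (s + δ)) (hi (s + δ) t)]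
          have : ∫ r in (s + δ)..t, χ r = 0 := by
            rw [intervalIntegral.integral_congr (g := fun _ => (0 : ℝ)),
              intervalIntegral.integral_zero]
            intro r hr
            rw [Set.uIcc_of_le h2] at hr
            exact hzero r (Or.inl hr.1)
          linarith [hle s (s + δ) (by linarith)]

variable {N : ℕ} {Ω : Set (Rn N)} {φ : Rn N → ℝ}

theorem IsTestFunction.comp (hφ : IsTestFunction Ω φ) {T : ℝ → ℝ} (hT : ContDiff ℝ ∞ T)
    (hT0 : T 0 = 0) : IsTestFunction Ω (fun x => T (φ x)) where
  smooth := hT.comp hφ.smooth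
  compact_support := hφ.compact_support.comp_left hT0
  support_subset := (closure_mono (Function.support_comp_subset hT0 φ)).trans hφ.support_subset

theorem IsTestFunction.gradient_comp (hφ : IsTestFunction Ω φ) {T : ℝ → ℝ} (hT : ContDiff ℝ ∞ T)
    (x : Rn N) : gradient (fun x => T (φ x)) x = deriv T (φ x) • gradient φ x := by
  refine HasGradientAt.gradient ?_
  have h1 := (hT.differentiable (by simp) (φ x)).hasDerivAt.comp_hasFDerivAt x
    (hφ.hasGradientAt x).hasFDerivAt
  rw [hasGradientAt_iff_hasFDerivAt, map_smul]
  exact h1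

/-- Truncating a test function, up to a uniform error `δ`, does not increase the energy. -/
theorem IsTestFunction.exists_clamp {p c C : ℝ} {Φ : Rn N → Rn N → ℝ} (hp : 1 < p) (hc : 0 ≤ c)
    (hΦ : IsConvexIntegrand (volume.restrict Ω) p c C Φ) (hφ : IsTestFunction Ω φ) {s δ : ℝ}
    (hs : 0 < s) (hδ : 0 < δ) :
    ∃ ψ, IsTestFunction Ω ψ ∧ (∀ x, |ψ x - clamp s (φ x)| ≤ δ) ∧
      energy (volume.restrict Ω) Φ (gradient ψ) ≤ energy (volume.restrict Ω) Φ (gradient φ) := by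
  obtain ⟨T, hT, hT0, hT1, hTc⟩ := exists_smooth_clamp hs hδ
  refine ⟨fun x => T (φ x), hφ.comp hT hT0, fun x => hTc _, ?_⟩
  refine integral_mono_ae (hΦ.integrable hc hp ((hφ.comp hT hT0).memLp_gradient _))
    (hΦ.integrable hc hp (hφ.memLp_gradient _)) ?_
  filter_upwards [hΦ.convex, hΦ.nonneg hc, hΦ.upper] with x h1 h2 h3
  rw [hφ.gradient_comp hT]
  obtain ⟨ht0, ht1⟩ := hT1 (φ x)
  have h4 := h1.2 (Set.mem_univ (gradient φ x)) (Set.mem_univ 0) ht0 (sub_nonneg.2 ht1) (by ring)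
  have h5 : Φ x 0 ≤ 0 := by
    have := h3 0
    rwa [norm_zero, Real.zero_rpow (by linarith), mul_zero] at this
  rw [smul_zero, add_zero, smul_eq_mul, smul_eq_mul] at h4
  have h6 : deriv T (φ x) * Φ x (gradient φ x) ≤ Φ x (gradient φ x) :=
    mul_le_of_le_one_left (h2 _) ht1
  have h7 : (1 - deriv T (φ x)) * Φ x 0 ≤ 0 :=
    mul_nonpos_of_nonneg_of_nonpos (sub_nonneg.2 ht1) h5
  linarith

end Truncation

/-! ### The truncated nonlinearity -/

section Nonlinearity

theorem hasDerivAt_primitive {f : ℝ → ℝ} (hf : Continuous f) (t : ℝ) :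
    HasDerivAt (primitive f) (f t) t :=
  intervalIntegral.integral_hasDerivAt_right (hf.intervalIntegrable 0 t)
    (hf.stronglyMeasurableAtFilter _ _) hf.continuousAt

theorem continuous_primitive {f : ℝ → ℝ} (hf : Continuous f) : Continuous (primitive f) :=
  continuous_iff_continuousAt.2 fun t => (hasDerivAt_primitive hf t).continuousAt

variable {f : ℝ → ℝ} {s : ℝ}

/-- The nonlinearity `f` frozen outside `[0, s]`. -/
noncomputable def clampFun (f : ℝ → ℝ) (s t : ℝ) : ℝ := f (clamp s t)

theorem continuous_clampFun (hf : Continuous f) (s : ℝ) : Continuous (clampFun f s) :=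
  hf.comp (continuous_clamp s)

theorem exists_abs_clampFun_le (hf : Continuous f) (hs : 0 ≤ s) :
    ∃ B : NNReal, ∀ t, |clampFun f s t| ≤ B := by
  obtain ⟨B, hB⟩ := (isCompact_Icc (a := (0 : ℝ)) (b := s)).exists_bound_of_continuousOn
    hf.continuousOn
  refine ⟨B.toNNReal, fun t => ?_⟩
  have := hB (clamp s t) ⟨clamp_nonneg s t, clamp_le hs t⟩
  exact this.trans (Real.le_coe_toNNReal B)

theorem lipschitzWith_primitive_clampFun (hf : Continuous f) {B : NNReal}
    (hB : ∀ t, |clampFun f s t| ≤ B) : LipschitzWith B (primitive (clampFun f s)) := by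
  refine lipschitzWith_of_nnnorm_deriv_le
    (fun t => (hasDerivAt_primitive (continuous_clampFun hf s) t).differentiableAt) fun t => ?_
  rw [(hasDerivAt_primitive (continuous_clampFun hf s) t).deriv]
  exact_mod_cast hB t

theorem primitive_clampFun_of_mem {t : ℝ} (h0 : 0 ≤ t) (hs : t ≤ s) :
    primitive (clampFun f s) t = primitive f t := by
  refine intervalIntegral.integral_congr fun r hr => ?_
  rw [Set.uIcc_of_le h0] at hr
  simp only [clampFun]
  rw [clamp_of_mem hr.1 (hr.2.trans hs)]

/-- Since `f 0 ≥ 0` and `f s = 0`, the truncated primitive is nondecreasing on `(-∞, 0]` and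
constant on `[s, ∞)`. -/
theorem primitive_clampFun_le (hf : Continuous f) (hf0 : 0 ≤ f 0) (hs : 0 ≤ s) (hfs : f s = 0)
    (t : ℝ) : primitive (clampFun f s) t ≤ primitive (clampFun f s) (clamp s t) := by
  have hi : ∀ a b : ℝ, IntervalIntegrable (clampFun f s) volume a b := fun a b =>
    (continuous_clampFun hf s).intervalIntegrable a b
  rcases le_total t 0 with h0 | h0
  · rw [clamp_of_nonpos h0]
    simp only [primitive]
    rw [intervalIntegral.integral_same, intervalIntegral.integral_symm, neg_nonpos]
    refine intervalIntegral.integral_nonneg h0 fun r hr => ?_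
    rw [clampFun, clamp_of_nonpos hr.2]
    exact hf0
  · rcases le_total t s with h1 | h1
    · rw [clamp_of_mem h0 h1]
    · rw [clamp_of_ge hs h1]
      simp only [primitive]
      rw [← intervalIntegral.integral_add_adjacent_intervals (hi 0 s) (hi s t),
        intervalIntegral.integral_congr (a := s) (b := t) (g := fun _ => (0 : ℝ)),
        intervalIntegral.integral_zero, add_zero]
      intro r hr
      rw [Set.uIcc_of_le h1] at hr
      simp only [clampFun]
      rw [clamp_of_ge hs hr.1, hfs]

end Nonlinearity

/-! ### Existence of a bounded minimiser -/

section Minimiser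

variable {X : Type*} [MeasurableSpace X] {μ : Measure X} {G : ℝ → ℝ} {K : NNReal}

theorem integrable_comp_lipschitz [IsFiniteMeasure μ] (hG : LipschitzWith K G) {u : X → ℝ}
    (hu : Integrable u μ) : Integrable (fun x => G (u x)) μ := by
  refine ((hu.norm.const_mul K).add (integrable_const ‖G 0‖)).mono'
    (hG.continuous.comp_aestronglyMeasurable hu.1) (Eventually.of_forall fun x => ?_)
  have h1 := hG.norm_sub_le (u x) 0
  rw [sub_zero] at h1
  have h2 := norm_sub_norm_le (G (u x)) (G 0)
  simp only [Pi.add_apply]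
  linarith

theorem tendsto_integral_comp_lipschitz [IsFiniteMeasure μ] {p : ℝ} (hp : 1 < p)
    (hG : LipschitzWith K G) {w : ℕ → X → ℝ} {w' : X → ℝ}
    (hw : ∀ k, MemLp (w k) (ENNReal.ofReal p) μ) (hw' : MemLp w' (ENNReal.ofReal p) μ)
    (hlim : Tendsto (fun k => eLpNorm (fun x => w' x - w k x) (ENNReal.ofReal p) μ) atTop (𝓝 0)) :
    Tendsto (fun k => ∫ x, G (w k x) ∂μ) atTop (𝓝 (∫ x, G (w' x) ∂μ)) := by
  have h1p : (1 : ℝ≥0∞) ≤ ENNReal.ofReal p := ENNReal.one_le_ofReal.2 hp.le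
  have hl1 := tendsto_eLpNorm_one hp hw hw' hlim
  refine tendsto_integral_of_L1 _ (integrable_comp_lipschitz hG (hw'.integrable h1p)).1
    (Eventually.of_forall fun k => integrable_comp_lipschitz hG ((hw k).integrable h1p)) ?_
  have h2 : Tendsto (fun k => (K : ℝ≥0∞) * eLpNorm (fun x => w' x - w k x) 1 μ)
      atTop (𝓝 0) := by
    simpa using ENNReal.Tendsto.const_mul hl1 (a := (K : ℝ≥0∞)) (Or.inr ENNReal.coe_ne_top)
  refine tendsto_of_tendsto_of_tendsto_of_le_of_le tendsto_const_nhds h2 (fun _ => bot_le)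
    fun k => ?_
  simp only
  rw [eLpNorm_one_eq_lintegral_enorm, ← lintegral_const_mul' _ _ ENNReal.coe_ne_top]
  refine lintegral_mono fun x => ?_
  rw [← edist_eq_enorm_sub, ← edist_eq_enorm_sub, edist_comm (w' x)]
  exact hG.edist_le_mul _ _

variable {N : ℕ} {Ω : Set (Rn N)} {p c C s : ℝ} {Φ : Rn N → Rn N → ℝ}

/-- The functional `∫ Φ(x, g) dμ - ∫ G(u) dμ`. -/
noncomputable def functional {E : Type*} (μ : Measure X) (Φ : X → E → ℝ) (G : ℝ → ℝ)
    (u : X → ℝ) (g : X → E) : ℝ :=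
  (∫ x, Φ x (g x) ∂μ) - ∫ x, G (u x) ∂μ

theorem functional_eq {E : Type*} [NormedAddCommGroup E] (μ : Measure X) (Φ : X → E → ℝ)
    (G : ℝ → ℝ) (u : X → ℝ) (g : X → E) :
    functional μ Φ G u g = energy μ Φ g - ∫ x, G (u x) ∂μ := rfl

/-- Every element of `W₀^{1,p}` is reached by test functions along which the functional
converges. -/
theorem MemW1p0.exists_tendsto_functional [IsFiniteMeasure (volume.restrict Ω)] (hp : 1 < p)
    (hc : 0 ≤ c) (hC : 0 ≤ C) (hΦ : IsConvexIntegrand (volume.restrict Ω) p c C Φ)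
    (hG : LipschitzWith K G) {v : Rn N → ℝ} {h : Rn N → Rn N} (hv : MemW1p0 Ω p v h) :
    ∃ φ : ℕ → Rn N → ℝ, (∀ k, IsTestFunction Ω (φ k)) ∧
      Tendsto (fun k => functional (volume.restrict Ω) Φ G (φ k) (gradient (φ k))) atTop
        (𝓝 (functional (volume.restrict Ω) Φ G v h)) := by
  obtain ⟨φ, hφ, h1, h2⟩ := hv.approx
  refine ⟨φ, hφ, ?_⟩
  have h3 := (tendsto_eLpNorm_zero_iff hp
    fun k => hv.memW1p.memLp_grad.sub ((hφ k).memLp_gradient _)).1 h2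
  have h4 := hΦ.tendsto_energy hc hC hp (fun k => (hφ k).memLp_gradient _) hv.memW1p.memLp_grad
    (h3.congr fun k => by simp_rw [Pi.sub_apply, norm_sub_rev])
  exact h4.sub (tendsto_integral_comp_lipschitz hp hG (fun k => (hφ k).memLp _) hv.memW1p.memLp h1)

/-- The functional has a minimiser over `W₀^{1,p}` with values in `[0, s]`, provided that truncation
at the levels `0` and `s` does not decrease `G`.

A minimising sequence of test functions can be truncated, and is then compact in `L^p`. Its limit
`u` is approximated in `L^p` by elements of the convex sets of almost minimal energy, and those of
almost minimal gradient norm among them have gradients that converge strongly in `L^p`. -/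
theorem exists_minimiser (hb : Bornology.IsBounded Ω) (hp : 1 < p) (hc : 0 < c) (hC : 0 ≤ C)
    (hΦ : IsConvexIntegrand (volume.restrict Ω) p c C Φ) (hs : 0 < s) (hG : LipschitzWith K G)
    (hGs : ∀ t, G t ≤ G (clamp s t)) :
    ∃ (u : Rn N → ℝ) (g : Rn N → Rn N), MemW1p0 Ω p u g ∧
      (∀ᵐ x ∂(volume.restrict Ω), 0 ≤ u x ∧ u x ≤ s) ∧
      ∀ (v : Rn N → ℝ) (h : Rn N → Rn N), MemW1p0 Ω p v h →
        functional (volume.restrict Ω) Φ G u g ≤ functional (volume.restrict Ω) Φ G v h := by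
  have h1p : (1 : ℝ≥0∞) ≤ ENNReal.ofReal p := ENNReal.one_le_ofReal.2 hp.le
  have hp0 : 0 < p := by linarith
  have hfinite : IsFiniteMeasure (volume.restrict Ω) := ⟨by simpa using hb.measure_lt_top⟩
  set μ : Measure (Rn N) := volume.restrict Ω with hμ
  set J : (Rn N → ℝ) → (Rn N → Rn N) → ℝ := functional μ Φ G with hJ
  set m₀ : ℝ := μ.real Set.univ with hm₀
  -- an upper bound for `G`
  set b : ℝ := G 0 + K * s with hbdef
  have hGb : ∀ t, G t ≤ b := by
    intro t
    refine (hGs t).trans ?_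
    have h1 := hG.dist_le_mul (clamp s t) 0
    rw [Real.dist_eq, Real.dist_eq, sub_zero, abs_of_nonneg (clamp_nonneg s t)] at h1
    have h2 : (K : ℝ) * clamp s t ≤ K * s := by gcongr; exact clamp_le hs.le t
    linarith [le_abs_self (G (clamp s t) - G 0)]
  have hGi : ∀ {φ}, IsTestFunction Ω φ → Integrable (fun x => G (φ x)) μ := fun hφ =>
    integrable_comp_lipschitz hG ((hφ.memLp 1).integrable le_rfl)
  have hGint : ∀ {φ}, IsTestFunction Ω φ → ∫ x, G (φ x) ∂μ ≤ b * m₀ := by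
    intro φ hφ
    refine (integral_mono (hGi hφ) (integrable_const b) fun x => hGb _).trans_eq ?_
    simp [hm₀, mul_comm]
  set S : Set ℝ := {r | ∃ φ, IsTestFunction Ω φ ∧ r = J φ (gradient φ)} with hS
  have hSne : S.Nonempty := by
    refine ⟨_, fun _ => 0, ⟨contDiff_const, HasCompactSupport.zero, ?_⟩, rfl⟩
    simp [tsupport]
  have hSb : BddBelow S := by
    refine ⟨-(b * m₀), ?_⟩
    rintro _ ⟨φ, hφ, rfl⟩
    rw [hJ, functional_eq]
    linarith [hGint hφ, hΦ.energy_nonneg hc.le (gradient φ)]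
  set m : ℝ := sInf S with hm
  obtain ⟨r, -, hrm, hrS⟩ := exists_seq_tendsto_sInf hSne hSb
  choose ψ hψ hψr using hrS
  have hδ : ∀ k : ℕ, (0 : ℝ) < 1 / (k + 1 : ℝ) := fun k => by positivity
  choose φ hφ hφc hφE using fun k => (hψ k).exists_clamp hp hc.le hΦ hs (hδ k)
  have hJφ : Tendsto (fun k => J (φ k) (gradient (φ k))) atTop (𝓝 m) := by
    have hup : Tendsto (fun k : ℕ => r k + K * m₀ * (1 / (k + 1 : ℝ))) atTop (𝓝 m) := by
      simpa using hrm.add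
        ((tendsto_one_div_add_atTop_nhds_zero_nat (𝕜 := ℝ)).const_mul (K * m₀))
    refine tendsto_of_tendsto_of_tendsto_of_le_of_le tendsto_const_nhds hup
      (fun k => csInf_le hSb ⟨φ k, hφ k, rfl⟩) fun k => ?_
    simp only
    rw [hψr k, hJ, functional_eq, functional_eq]
    have h1 : ∫ x, G (ψ k x) ∂μ ≤ ∫ x, (G (φ k x) + K * (1 / (k + 1 : ℝ))) ∂μ := by
      refine integral_mono (hGi (hψ k)) ((hGi (hφ k)).add (integrable_const _)) fun x => ?_
      refine (hGs _).trans ?_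
      have h2 := hG.dist_le_mul (clamp s (ψ k x)) (φ k x)
      rw [Real.dist_eq, Real.dist_eq, abs_sub_comm (clamp s (ψ k x))] at h2
      have h3 : (K : ℝ) * |φ k x - clamp s (ψ k x)| ≤ K * (1 / (k + 1 : ℝ)) := by
        gcongr
        exact hφc k x
      linarith [le_abs_self (G (clamp s (ψ k x)) - G (φ k x))]
    rw [integral_add (hGi (hφ k)) (integrable_const _), integral_const, smul_eq_mul,
      ← hm₀] at h1
    have h4 := hφE k
    rw [← hμ] at h4
    linarith [show m₀ * (K * (1 / (k + 1 : ℝ))) = K * m₀ * (1 / (k + 1 : ℝ)) by ring]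
  have hδ1 : ∀ k : ℕ, 1 / (k + 1 : ℝ) ≤ 1 := fun k => by
    rw [div_le_one (by positivity)]
    linarith [(Nat.cast_nonneg k : (0 : ℝ) ≤ k)]
  have hφbd : ∀ k x, ‖φ k x‖ ≤ s + 1 := by
    intro k x
    have h1 := abs_le.1 (hφc k x)
    rw [Real.norm_eq_abs, abs_le]
    constructor
    · linarith [clamp_nonneg s (ψ k x), hδ1 k]
    · linarith [clamp_le hs.le (ψ k x), hδ1 k]
  -- the gradients are bounded in `L^p`, hence in `L¹`
  obtain ⟨R, hR⟩ : ∃ R, ∀ k, J (φ k) (gradient (φ k)) ≤ R := by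
    obtain ⟨R, hR⟩ := hJφ.bddAbove_range
    exact ⟨R, fun k => hR ⟨k, rfl⟩⟩
  have hgradp : ∀ k, ∫ x, ‖gradient (φ k) x‖ ^ p ∂μ ≤ (R + b * m₀) / c := by
    intro k
    rw [le_div_iff₀' hc]
    have h1 := hΦ.le_energy hc.le hp ((hφ k).memLp_gradient (ENNReal.ofReal p))
    have h2 := hR k
    rw [hJ, functional_eq] at h2
    linarith [hGint (hφ k)]
  have hgrad1 : ∀ k, ∫⁻ x, ‖fderiv ℝ (φ k) x‖ₑ ≤ ENNReal.ofReal (m₀ + (R + b * m₀) / c) := by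
    intro k
    have hi := integrable_norm_rpow_of_memLp hp ((hφ k).memLp_gradient (ENNReal.ofReal p))
    have e1 : ∀ x, ‖fderiv ℝ (φ k) x‖ₑ = ‖gradient (φ k) x‖ₑ := fun x => by
      rw [gradient, LinearIsometryEquiv.enorm_map]
    simp_rw [e1]
    rw [← setLIntegral_eq_of_support_subset (s := Ω), ← ofReal_integral_norm_eq_lintegral_enorm
      (((hφ k).memLp_gradient 1).integrable le_rfl)]
    · apply ENNReal.ofReal_le_ofReal
      have h1 : ∫ x, ‖gradient (φ k) x‖ ∂μ ≤ ∫ x, (1 + ‖gradient (φ k) x‖ ^ p) ∂μ := by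
        refine integral_mono (((hφ k).memLp_gradient 1).integrable le_rfl).norm
          ((integrable_const _).add hi) fun x => ?_
        simp only
        rcases le_total ‖gradient (φ k) x‖ 1 with h | h
        · linarith [Real.rpow_nonneg (norm_nonneg (gradient (φ k) x)) p]
        · have := Real.self_le_rpow_of_one_le h hp.le
          linarith
      rw [integral_add (integrable_const _) hi, integral_const, smul_eq_mul, mul_one, ← hm₀] at h1
      linarith [hgradp k]
    · intro x hx
      by_contra hxΩ
      exact hx (by simp [(hφ k).gradient_eq_zero_of_notMem hxΩ])
  obtain ⟨σ, hσ, u, hum, hu⟩ := exists_subseq_tendsto_ae hb hφ hφbd ENNReal.ofReal_ne_top hgrad1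
  rw [← hμ] at hum hu
  have hu0 : ∀ᵐ x ∂μ, 0 ≤ u x ∧ u x ≤ s := by
    filter_upwards [hu] with x hx
    have hz := (tendsto_one_div_add_atTop_nhds_zero_nat (𝕜 := ℝ)).comp hσ.tendsto_atTop
    constructor
    · refine le_of_tendsto_of_tendsto (by simpa using hz.neg) hx (Eventually.of_forall fun k => ?_)
      have h1 := abs_le.1 (hφc (σ k) x)
      have h2 := clamp_nonneg s (ψ (σ k) x)
      rw [one_div] at h1
      linarith
    · refine le_of_tendsto_of_tendsto hx (by simpa using hz.const_add s)
        (Eventually.of_forall fun k => ?_)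
      have h1 := abs_le.1 (hφc (σ k) x)
      have h2 := clamp_le hs.le (ψ (σ k) x)
      rw [one_div] at h1
      linarith
  have hup : MemLp u (ENNReal.ofReal p) μ := MemLp.of_bound hum s (by
    filter_upwards [hu0] with x hx
    rw [Real.norm_of_nonneg hx.1]
    exact hx.2)
  have hφu : Tendsto (fun k => eLpNorm (fun x => u x - φ (σ k) x) (ENNReal.ofReal p) μ)
      atTop (𝓝 0) := by
    refine (tendsto_eLpNorm_zero_iff hp fun k => hup.sub ((hφ (σ k)).memLp _)).2 ?_
    have := tendsto_integral_of_dominated_convergence (μ := μ)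
      (F := fun k x => ‖u x - φ (σ k) x‖ ^ p) (f := fun _ => 0)
      (fun _ => (s + (s + 1)) ^ p)
      (fun k => (integrable_norm_rpow_of_memLp hp (hup.sub ((hφ (σ k)).memLp _))).1)
      (integrable_const _) (fun k => ?_) ?_
    · simpa using this
    · filter_upwards [hu0] with x hx
      rw [Real.norm_of_nonneg (by positivity)]
      gcongr
      refine (norm_sub_le _ _).trans (add_le_add ?_ (hφbd _ x))
      rw [Real.norm_of_nonneg hx.1]
      exact hx.2
    · filter_upwards [hu] with x hx
      have h1 : Tendsto (fun k => ‖u x - φ (σ k) x‖) atTop (𝓝 0) := by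
        simpa using (hx.const_sub (u x)).norm
      have h2 := h1.rpow_const (p := p) (Or.inr hp0.le)
      rwa [Real.zero_rpow hp0.ne'] at h2
  -- the limit energy
  set e : ℝ := m + ∫ x, G (u x) ∂μ with he
  have hEe : Tendsto (fun k => energy μ Φ (gradient (φ (σ k)))) atTop (𝓝 e) := by
    have h1 := tendsto_integral_comp_lipschitz hp hG (fun k => (hφ (σ k)).memLp _) hup hφu
    refine ((hJφ.comp hσ.tendsto_atTop).add h1).congr fun k => ?_
    simp only [Function.comp_apply, hJ, functional_eq]
    ring
  set A : ℕ → Set (Rn N → Rn N) := fun n => {h | ∃ v, MemW1p0 Ω p v h ∧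
    energy μ Φ h ≤ e + 1 / (n + 1 : ℝ) ∧
    eLpNorm (fun x => u x - v x) (ENNReal.ofReal p) μ ≤ (n + 1 : ℝ≥0∞)⁻¹} with hA
  have hAe : ∀ n, ∃ k, gradient (φ (σ k)) ∈ A n := by
    intro n
    have hε : (0 : ℝ≥0∞) < (n + 1 : ℝ≥0∞)⁻¹ := ENNReal.inv_pos.2 (by finiteness)
    obtain ⟨k, hk1, hk2⟩ := ((hEe.eventually (gt_mem_nhds (lt_add_of_pos_right e (hδ n)))).and
      (hφu.eventually (gt_mem_nhds hε))).exists
    exact ⟨k, φ (σ k), (hφ (σ k)).memW1p0 hp, hk1.le, hk2.le⟩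
  have hAanti : Antitone A := by
    intro i j hij h ⟨v, hv, h1, h2⟩
    refine ⟨v, hv, h1.trans ?_, h2.trans ?_⟩
    · have : 1 / (j + 1 : ℝ) ≤ 1 / (i + 1 : ℝ) := by
        apply one_div_le_one_div_of_le (by positivity)
        have : (i : ℝ) ≤ j := by exact_mod_cast hij
        linarith
      linarith
    · apply ENNReal.inv_le_inv.2
      gcongr
  have hAmid : ∀ n, ∀ h ∈ A n, ∀ h' ∈ A n, (fun x => (1 / 2 : ℝ) • (h x + h' x)) ∈ A n := by
    rintro n h ⟨v, hv, hv1, hv2⟩ h' ⟨v', hv', hv1', hv2'⟩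
    have hadd := (hv.add_mul hp hv' 1).const_mul hp (1 / 2)
    simp only [one_smul, one_mul] at hadd
    refine ⟨_, hadd, ?_, ?_⟩
    · have i1 := hΦ.integrable hc.le hp hv.memW1p.memLp_grad
      have i2 := hΦ.integrable hc.le hp hv'.memW1p.memLp_grad
      have h1 : energy μ Φ (fun x => (1 / 2 : ℝ) • (h x + h' x))
          ≤ ∫ x, (1 / 2 * Φ x (h x) + 1 / 2 * Φ x (h' x)) ∂μ := by
        refine integral_mono_ae (hΦ.integrable hc.le hp hadd.memW1p.memLp_grad)
          ((i1.const_mul _).add (i2.const_mul _)) ?_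
        filter_upwards [hΦ.convex] with x hx
        have := hx.2 (Set.mem_univ (h x)) (Set.mem_univ (h' x))
          (show (0 : ℝ) ≤ 1 / 2 by norm_num) (show (0 : ℝ) ≤ 1 / 2 by norm_num) (by norm_num)
        rw [smul_add]
        exact this
      rw [integral_add (i1.const_mul _) (i2.const_mul _), integral_const_mul,
        integral_const_mul] at h1
      have h2 : ∫ x, Φ x (h x) ∂μ ≤ e + 1 / (n + 1 : ℝ) := hv1
      have h3 : ∫ x, Φ x (h' x) ∂μ ≤ e + 1 / (n + 1 : ℝ) := hv1'
      linarith
    · have e1 : (fun x => u x - 1 / 2 * (v x + v' x))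
          = (1 / 2 : ℝ) • ((u - v) + (u - v')) := by
        ext x
        simp only [Pi.smul_apply, Pi.add_apply, Pi.sub_apply, smul_eq_mul]
        ring
      rw [e1, eLpNorm_const_smul]
      have h2 := eLpNorm_add_le (hup.sub hv.memW1p.memLp).1 (hup.sub hv'.memW1p.memLp).1 h1p
      have hhalf : ‖(1 / 2 : ℝ)‖ₑ = 2⁻¹ := by
        rw [Real.enorm_of_nonneg (by norm_num), one_div, ENNReal.ofReal_inv_of_pos (by norm_num)]
        simp
      rw [hhalf]
      calc _ ≤ 2⁻¹ * ((n + 1 : ℝ≥0∞)⁻¹ + (n + 1 : ℝ≥0∞)⁻¹) := by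
            gcongr
            exact h2.trans (add_le_add hv2 hv2')
        _ = (n + 1 : ℝ≥0∞)⁻¹ := by
            rw [← two_mul, ← mul_assoc, ENNReal.inv_mul_cancel (by simp) (by simp), one_mul]
  obtain ⟨h, hhA, g, hg, hhg⟩ := exists_tendsto_of_antitone_midpoint hp hAanti
    (fun n h ⟨v, hv, _⟩ => hv.memW1p.memLp_grad) hAmid
    (fun n => by
      obtain ⟨k, hk⟩ := hAe n
      exact ⟨_, hk, hgradp (σ k)⟩)
  choose v hv hvE hvu using hhA
  have hug : MemW1p0 Ω p u g := by
    refine MemW1p0.of_tendsto_memW1p0 hp hup hg hv ?_ ?_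
    · refine tendsto_of_tendsto_of_tendsto_of_le_of_le tendsto_const_nhds ?_ (fun _ => bot_le) hvu
      have := (tendsto_add_atTop_iff_nat 1).2 ENNReal.tendsto_inv_nat_nhds_zero
      simpa using this
    · refine (tendsto_eLpNorm_zero_iff hp fun k => hg.sub (hv k).memW1p.memLp_grad).2 ?_
      exact hhg.congr fun k => by simp_rw [Pi.sub_apply, norm_sub_rev]
  refine ⟨u, g, hug, hu0, fun v' h' hv' => ?_⟩
  have hle : J u g ≤ m := by
    have h1 := hΦ.tendsto_energy hc.le hC hp (fun k => (hv k).memW1p.memLp_grad) hg hhg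
    have h2 : Tendsto (fun n : ℕ => e + 1 / (n + 1 : ℝ)) atTop (𝓝 e) := by
      simpa using (tendsto_one_div_add_atTop_nhds_zero_nat (𝕜 := ℝ)).const_add e
    have h3 := le_of_tendsto_of_tendsto' h1 h2 hvE
    rw [hJ, functional_eq]
    linarith
  obtain ⟨w, hw, hwlim⟩ := hv'.exists_tendsto_functional hp hc.le hC hΦ hG
  exact hle.trans (ge_of_tendsto' hwlim fun k => csInf_le hSb ⟨w k, hw k, rfl⟩)

end Minimiser

/-! ### The Euler–Lagrange equation -/

section EulerLagrange

/-- Difference quotients of a nonnegative convex function are bounded by its values at the two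
points `ξ ± η`. -/
theorem abs_slope_le_of_convexOn {E : Type*} [NormedAddCommGroup E] [NormedSpace ℝ E] {φ : E → ℝ}
    (hφ : ConvexOn ℝ Set.univ φ) (hn : ∀ ξ, 0 ≤ φ ξ) (ξ η : E) {t : ℝ} (h0 : 0 < t) (h1 : t ≤ 1) :
    |t⁻¹ * (φ (ξ + t • η) - φ ξ)| ≤ φ (ξ + η) + φ (ξ - η) := by
  have hup : φ (ξ + t • η) - φ ξ ≤ t * φ (ξ + η) := by
    have h := hφ.2 (Set.mem_univ (ξ + η)) (Set.mem_univ ξ) h0.le (sub_nonneg.2 h1) (by ring)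
    have e : t • (ξ + η) + (1 - t) • ξ = ξ + t • η := by
      rw [smul_add, sub_smul, one_smul]; abel
    rw [e, smul_eq_mul, smul_eq_mul] at h
    nlinarith [hn ξ]
  have hlo : -(t * φ (ξ - η)) ≤ φ (ξ + t • η) - φ ξ := by
    have ht : 0 < 1 + t := by linarith
    have h := hφ.2 (Set.mem_univ (ξ + t • η)) (Set.mem_univ (ξ - η))
      (inv_pos.2 ht).le (by positivity : 0 ≤ (1 + t)⁻¹ * t) (by field_simp)
    have e : (1 + t)⁻¹ • (ξ + t • η) + ((1 + t)⁻¹ * t) • (ξ - η) = ξ := by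
      rw [mul_smul, ← smul_add, smul_sub, show ξ + t • η + (t • ξ - t • η) = (1 + t) • ξ by
        rw [add_smul, one_smul]; abel, smul_smul, inv_mul_cancel₀ ht.ne', one_smul]
    rw [e, smul_eq_mul, smul_eq_mul, mul_assoc, ← mul_add, inv_mul_eq_div, le_div_iff₀ ht] at h
    nlinarith [hn ξ]
  rw [abs_le]
  constructor
  · rw [inv_mul_eq_div, le_div_iff₀ h0]
    nlinarith [hn (ξ + η)]
  · rw [inv_mul_eq_div, div_le_iff₀ h0]
    nlinarith [hn (ξ - η)]

theorem tendsto_slope_one_div {φ : ℝ → ℝ} {d : ℝ} (h : HasDerivAt φ d 0) :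
    Tendsto (fun n : ℕ => (1 / (n + 1 : ℝ))⁻¹ * (φ (1 / (n + 1 : ℝ)) - φ 0)) atTop (𝓝 d) := by
  have h1 := hasDerivAt_iff_tendsto_slope_zero.1 h
  simp only [zero_add, smul_eq_mul] at h1
  refine h1.comp (tendsto_nhdsWithin_iff.2
    ⟨tendsto_one_div_add_atTop_nhds_zero_nat (𝕜 := ℝ), Eventually.of_forall fun n => ?_⟩)
  have : (0 : ℝ) < 1 / (n + 1 : ℝ) := by positivity
  exact this.ne'

variable {N : ℕ} {Ω : Set (Rn N)} {p c C : ℝ} {Φ : Rn N → Rn N → ℝ} {a : Rn N → Rn N → Rn N}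

theorem one_div_succ_pos_le_one (n : ℕ) : 0 < 1 / (n + 1 : ℝ) ∧ 1 / (n + 1 : ℝ) ≤ 1 := by
  refine ⟨by positivity, ?_⟩
  rw [div_le_one (by positivity)]
  linarith [(Nat.cast_nonneg n : (0 : ℝ) ≤ n)]

/-- The right derivative of the energy at `g` in the direction `h`. -/
theorem IsVariationalOperator.tendsto_energy_slope (ha : IsVariationalOperator Ω p Φ a)
    (hΦ : IsConvexIntegrand (volume.restrict Ω) p c C Φ) (hc : 0 ≤ c) (hp : 1 < p)
    {g h : Rn N → Rn N} (hg : MemLp g (ENNReal.ofReal p) (volume.restrict Ω))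
    (hh : MemLp h (ENNReal.ofReal p) (volume.restrict Ω)) :
    IntegrableOn (fun x => inner ℝ (a x (g x)) (h x)) Ω ∧
    Tendsto (fun n : ℕ => (1 / (n + 1 : ℝ))⁻¹ *
      (energy (volume.restrict Ω) Φ (fun x => g x + (1 / (n + 1 : ℝ)) • h x)
        - energy (volume.restrict Ω) Φ g)) atTop
      (𝓝 (∫ x in Ω, inner ℝ (a x (g x)) (h x))) := by
  have hlim : ∀ᵐ x ∂(volume.restrict Ω), Tendsto (fun n : ℕ => (1 / (n + 1 : ℝ))⁻¹ *
      (Φ x (g x + (1 / (n + 1 : ℝ)) • h x) - Φ x (g x))) atTop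
      (𝓝 (inner ℝ (a x (g x)) (h x))) := by
    filter_upwards [ha.potential] with x hx
    simpa using tendsto_slope_one_div (hasDerivAt_comp_line (hx.2 (g x)) (h x))
  have hbound : ∀ n : ℕ, ∀ᵐ x ∂(volume.restrict Ω), ‖(1 / (n + 1 : ℝ))⁻¹ *
      (Φ x (g x + (1 / (n + 1 : ℝ)) • h x) - Φ x (g x))‖
      ≤ Φ x (g x + h x) + Φ x (g x - h x) := by
    intro n
    filter_upwards [hΦ.convex, hΦ.nonneg hc] with x h1 h2
    exact abs_slope_le_of_convexOn h1 h2 _ _ (one_div_succ_pos_le_one n).1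
      (one_div_succ_pos_le_one n).2
  have hbi : Integrable (fun x => Φ x (g x + h x) + Φ x (g x - h x)) (volume.restrict Ω) :=
    (hΦ.integrable hc hp (hg.add hh)).add (hΦ.integrable hc hp (hg.sub hh))
  have hit : ∀ n : ℕ, Integrable (fun x => Φ x (g x + (1 / (n + 1 : ℝ)) • h x))
      (volume.restrict Ω) := fun n => 
      hΦ.integrable hc hp (hg.add (hh.const_smul (1 / (n + 1 : ℝ))))
  have hig := hΦ.integrable hc hp hg
  constructor
  · refine hbi.mono' ((aemeasurable_caratheodory_comp ha.caratheodory.measurable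
      ha.caratheodory.continuous hg.1).inner hh.1.aemeasurable).aestronglyMeasurable ?_
    filter_upwards [hlim, ae_all_iff.2 hbound] with x h1 h2
    exact le_of_tendsto h1.norm (Eventually.of_forall h2)
  · refine (tendsto_integral_of_dominated_convergence _
      (fun n => (((hit n).sub hig).const_mul _).1) hbi hbound hlim).congr fun n => ?_
    rw [energy, energy, ← integral_sub (hit n) hig, ← integral_const_mul]
    rfl

theorem tendsto_integral_lipschitz_slope {X : Type*} [MeasurableSpace X] {μ : Measure X}
    [IsFiniteMeasure μ] {G G' : ℝ → ℝ} {K : NNReal} (hG : LipschitzWith K G)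
    (hG' : ∀ t, HasDerivAt G (G' t) t) (hGc : Continuous G') {u v : X → ℝ}
    (hu : Integrable u μ) (hv : Integrable v μ) :
    Integrable (fun x => G' (u x) * v x) μ ∧
    Tendsto (fun n : ℕ => (1 / (n + 1 : ℝ))⁻¹ *
      ((∫ x, G (u x + (1 / (n + 1 : ℝ)) * v x) ∂μ) - ∫ x, G (u x) ∂μ)) atTop
      (𝓝 (∫ x, G' (u x) * v x ∂μ)) := by
  have hlim : ∀ x, Tendsto (fun n : ℕ => (1 / (n + 1 : ℝ))⁻¹ *
      (G (u x + (1 / (n + 1 : ℝ)) * v x) - G (u x))) atTop (𝓝 (G' (u x) * v x)) := by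
    intro x
    have h1 : HasDerivAt (fun t : ℝ => u x + t * v x) (v x) 0 := by
      simpa using ((hasDerivAt_id (0 : ℝ)).mul_const (v x)).const_add (u x)
    have h2 : HasDerivAt (fun t : ℝ => G (u x + t * v x)) (G' (u x) * v x) 0 := by
      refine HasDerivAt.comp (0 : ℝ) ?_ h1
      simpa using hG' (u x)
    simpa using tendsto_slope_one_div h2
  have hbound : ∀ (n : ℕ) x, ‖(1 / (n + 1 : ℝ))⁻¹ *
      (G (u x + (1 / (n + 1 : ℝ)) * v x) - G (u x))‖ ≤ K * ‖v x‖ := by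
    intro n x
    have ht := (one_div_succ_pos_le_one n).1
    have h1 := hG.norm_sub_le (u x + (1 / (n + 1 : ℝ)) * v x) (u x)
    rw [add_sub_cancel_left, norm_mul, Real.norm_of_nonneg ht.le] at h1
    rw [norm_mul, Real.norm_of_nonneg (inv_pos.2 ht).le, inv_mul_eq_div, div_le_iff₀ ht]
    linarith
  have hit : ∀ n : ℕ, Integrable (fun x => G (u x + (1 / (n + 1 : ℝ)) * v x)) μ := fun n =>
    integrable_comp_lipschitz hG (hu.add (hv.const_mul _))
  have hig := integrable_comp_lipschitz hG hu
  constructor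
  · refine (hv.norm.const_mul K).mono' ((hGc.comp_aestronglyMeasurable hu.1).mul hv.1)
      (Eventually.of_forall fun x => ?_)
    exact le_of_tendsto (hlim x).norm (Eventually.of_forall fun n => hbound n x)
  · refine (tendsto_integral_of_dominated_convergence _
      (fun n => (((hit n).sub hig).const_mul (1 / (n + 1 : ℝ))⁻¹).1) (hv.norm.const_mul K)
      (fun n => Eventually.of_forall (hbound n)) (Eventually.of_forall hlim)).congr fun n => ?_
    rw [← integral_sub (hit n) hig, ← integral_const_mul]
    rfl

/-- A minimiser satisfies the weak form of the Euler–Lagrange equation: the one-sided derivatives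
of the functional in the directions `(v, h)` and `(-v, -h)` are both nonnegative. -/
theorem IsVariationalOperator.eulerLagrange [IsFiniteMeasure (volume.restrict Ω)]
    (ha : IsVariationalOperator Ω p Φ a)
    (hΦ : IsConvexIntegrand (volume.restrict Ω) p c C Φ) (hc : 0 ≤ c) (hp : 1 < p)
    {G G' : ℝ → ℝ} {K : NNReal} (hG : LipschitzWith K G)
    (hG' : ∀ t, HasDerivAt G (G' t) t) (hGc : Continuous G') {u : Rn N → ℝ} {g : Rn N → Rn N}
    (hu : MemW1p0 Ω p u g)
    (hmin : ∀ (v : Rn N → ℝ) (h : Rn N → Rn N), MemW1p0 Ω p v h →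
      functional (volume.restrict Ω) Φ G u g ≤ functional (volume.restrict Ω) Φ G v h)
    {v : Rn N → ℝ} {h : Rn N → Rn N} (hv : MemW1p0 Ω p v h) :
    IntegrableOn (fun x => inner ℝ (a x (g x)) (h x)) Ω ∧
      IntegrableOn (fun x => G' (u x) * v x) Ω ∧
      ∫ x in Ω, inner ℝ (a x (g x)) (h x) = ∫ x in Ω, G' (u x) * v x := by
  have h1p : (1 : ℝ≥0∞) ≤ ENNReal.ofReal p := ENNReal.one_le_ofReal.2 hp.le
  have key : ∀ {v : Rn N → ℝ} {h : Rn N → Rn N}, MemW1p0 Ω p v h →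
      ∫ x in Ω, G' (u x) * v x ≤ ∫ x in Ω, inner ℝ (a x (g x)) (h x) := by
    intro v h hv
    have h1 := (ha.tendsto_energy_slope hΦ hc hp hu.memW1p.memLp_grad hv.memW1p.memLp_grad).2
    have h2 := (tendsto_integral_lipschitz_slope hG hG' hGc (hu.memW1p.memLp.integrable h1p)
      (hv.memW1p.memLp.integrable h1p)).2
    refine le_of_tendsto_of_tendsto' h2 h1 fun n => ?_
    have hn := (one_div_succ_pos_le_one n).1
    have h3 := hmin _ _ (hu.add_mul hp hv (1 / (n + 1 : ℝ)))
    rw [functional_eq, functional_eq] at h3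
    exact mul_le_mul_of_nonneg_left (by linarith) (inv_pos.2 hn).le
  refine ⟨(ha.tendsto_energy_slope hΦ hc hp hu.memW1p.memLp_grad hv.memW1p.memLp_grad).1,
    (tendsto_integral_lipschitz_slope hG hG' hGc (hu.memW1p.memLp.integrable h1p)
      (hv.memW1p.memLp.integrable h1p)).1, le_antisymm ?_ (key hv)⟩
  have h1 := key (hv.const_mul hp (-1))
  simp only [neg_mul, one_mul, mul_neg, neg_smul, one_smul, inner_neg_right, integral_neg] at h1
  linarith

end EulerLagrange

/-! ### Solutions below a zero of the nonlinearity -/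

section Solutions

variable {N : ℕ} {Ω : Set (Rn N)} {p : ℝ} {Φ : Rn N → Rn N → ℝ} {a : Rn N → Rn N → Rn N}
  {f : ℝ → ℝ}

/-- Below a zero `s` of `f` there is a weak solution whose energy is at most that of every test
function with values in `[0, s]`. Since `Φ ≥ 0`, this bounds `∫ F(u)` from below. -/
theorem IsVariationalOperator.exists_isWeakSolution (hb : Bornology.IsBounded Ω) (hp : 1 < p)
    (ha : IsVariationalOperator Ω p Φ a) {α β : ℝ} (hα : 0 < α) (hαβ : α ≤ β)
    (hg : ∀ᵐ x ∂(volume.restrict Ω), ∀ ξ,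
      α / p * ‖ξ‖ ^ p ≤ Φ x ξ ∧ Φ x ξ ≤ β / p * ‖ξ‖ ^ p)
    (hf : Continuous f) (hf0 : 0 ≤ f 0) {s : ℝ} (hs : 0 < s) (hfs : f s = 0) {lam : ℝ}
    (hlam : 0 < lam) :
    ∃ u : Rn N → ℝ, IsWeakSolution Ω p a f lam u ∧
      (∀ᵐ x ∂(volume.restrict Ω), 0 ≤ u x ∧ u x ≤ s) ∧
      MemLp u ⊤ (volume.restrict Ω) ∧
      ∀ φ, IsTestFunction Ω φ → (∀ x, 0 ≤ φ x ∧ φ x ≤ s) →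
        lam * (∫ x in Ω, primitive f (φ x)) - β / p * (∫ x in Ω, ‖gradient φ x‖ ^ p)
          ≤ lam * ∫ x in Ω, primitive f (u x) := by
  have hp0 : 0 < p := by linarith
  have hfinite : IsFiniteMeasure (volume.restrict Ω) := ⟨by simpa using hb.measure_lt_top⟩
  have hc : 0 < α / p := by positivity
  have hβ : 0 < β := by linarith
  have hC : 0 ≤ β / p := by positivity
  have hΦ := ha.isConvexIntegrand hg
  obtain ⟨B, hB⟩ := exists_abs_clampFun_le hf hs.le
  have hL := lipschitzWith_primitive_clampFun hf hB
  set G : ℝ → ℝ := fun t => lam * primitive (clampFun f s) t with hG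
  have hGL : LipschitzWith (Real.nnabs lam * B) G := (lipschitzWith_smul lam).comp hL
  have hGd : ∀ t, HasDerivAt G (lam * clampFun f s t) t := fun t =>
    (hasDerivAt_primitive (continuous_clampFun hf s) t).const_mul lam
  obtain ⟨u, g, hug, hu, hmin⟩ := exists_minimiser hb hp hc hC hΦ hs hGL
    (fun t => mul_le_mul_of_nonneg_left (primitive_clampFun_le hf hf0 hs.le hfs t) hlam.le)
  refine ⟨u, ⟨g, hug, fun v h hv => ?_⟩, hu, ?_, fun φ hφ hφs => ?_⟩
  · obtain ⟨h1, h2, h3⟩ := ha.eulerLagrange hΦ hc.le hp hGL hGd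
      (continuous_const.mul (continuous_clampFun hf s)) hug hmin hv
    have hae : (fun x => lam * clampFun f s (u x) * v x) =ᵐ[volume.restrict Ω]
        fun x => lam * (f (u x) * v x) := by
      filter_upwards [hu] with x hx
      rw [clampFun, clamp_of_mem hx.1 hx.2, mul_assoc]
    refine ⟨h1, ?_, ?_⟩
    · have h4 := (Integrable.congr h2 hae).const_mul lam⁻¹
      refine h4.congr (Eventually.of_forall fun x => ?_)
      simp only
      rw [inv_mul_cancel_left₀ hlam.ne']
    · rw [h3, integral_congr_ae hae, integral_const_mul]
  · refine MemLp.of_bound hug.memW1p.memLp.1 s ?_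
    filter_upwards [hu] with x hx
    rw [Real.norm_of_nonneg hx.1]
    exact hx.2
  · have h1 := hmin φ _ (hφ.memW1p0 hp)
    rw [functional_eq, functional_eq] at h1
    have h2 := hΦ.energy_le hc.le hp (hφ.memLp_gradient (ENNReal.ofReal p))
    have h3 := hΦ.energy_nonneg hc.le g
    have e1 : ∫ x in Ω, G (u x) = lam * ∫ x in Ω, primitive f (u x) := by
      rw [← integral_const_mul]
      refine integral_congr_ae ?_
      filter_upwards [hu] with x hx
      simp only [hG]
      rw [primitive_clampFun_of_mem hx.1 hx.2]
    have e2 : ∫ x in Ω, G (φ x) = lam * ∫ x in Ω, primitive f (φ x) := by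
      rw [← integral_const_mul]
      refine integral_congr_ae (Eventually.of_forall fun x => ?_)
      simp only [hG]
      rw [primitive_clampFun_of_mem (hφs x).1 (hφs x).2]
    rw [e1, e2] at h1
    linarith

/-- A cutoff function equal to `1` outside a set of arbitrarily small relative measure. -/
theorem exists_cutoff (hΩ : IsOpen Ω) (hne : Ω.Nonempty) (hb : Bornology.IsBounded Ω) {M : ℝ}
    (hM : 0 ≤ M) : ∃ (φ : Rn N → ℝ) (K : Set (Rn N)), IsTestFunction Ω φ ∧
      (∀ x, 0 ≤ φ x ∧ φ x ≤ 1) ∧ MeasurableSet K ∧ K ⊆ Ω ∧ (∀ x ∈ K, φ x = 1) ∧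
      0 < volume.real K - M * volume.real (Ω \ K) := by
  have hfin : volume Ω ≠ ⊤ := hb.measure_lt_top.ne
  have hpos : 0 < volume.real Ω := ENNReal.toReal_pos (hΩ.measure_pos _ hne).ne' hfin
  have hlt : ENNReal.ofReal (volume.real Ω * (M / (M + 1))) < volume Ω := by
    rw [ENNReal.ofReal_lt_iff_lt_toReal (by positivity) hfin]
    refine mul_lt_of_lt_one_right hpos ?_
    rw [div_lt_one (by positivity)]
    linarith
  obtain ⟨K, hKΩ, hK, hKlt⟩ := hΩ.exists_lt_isCompact hlt
  obtain ⟨K', hK', hKK', hK'Ω⟩ := exists_compact_between hK hΩ hKΩ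
  obtain ⟨φ, hφ, hφr, hφs, hφ1⟩ := exists_contMDiff_support_eq_eq_one_iff
    (modelWithCornersSelf ℝ (Rn N)) (n := (⊤ : ℕ∞)) isOpen_interior hK.isClosed hKK'
  have hts : tsupport φ ⊆ K' := by
    rw [tsupport, hφs]
    exact hK'.isClosed.closure_subset_iff.2 interior_subset
  refine ⟨φ, K, ⟨hφ.contDiff, hK'.of_isClosed_subset (isClosed_tsupport _) hts, hts.trans hK'Ω⟩,
    fun x => hφr ⟨x, rfl⟩, hK.measurableSet, hKΩ, fun x hx => (hφ1 x).1 hx, ?_⟩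
  rw [ENNReal.ofReal_lt_iff_lt_toReal (by positivity) (hK.measure_lt_top.ne)] at hKlt
  change _ < volume.real K at hKlt
  have hdiff : volume.real (Ω \ K) = volume.real Ω - volume.real K :=
    measureReal_sdiff hKΩ hK.measurableSet hfin
  rw [hdiff]
  have h1 : volume.real Ω * (M / (M + 1)) * (M + 1) < volume.real K * (M + 1) := by gcongr
  have h2 : volume.real Ω * (M / (M + 1)) * (M + 1) = volume.real Ω * M := by field_simp
  linarith

/-- The lower bound `-M F(γ)` on `[0, γ]` makes the part of `Ω` where the cutoff function is
different from `1` negligible. -/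
theorem le_integral_primitive_cutoff (hΩ : MeasurableSet Ω) (hb : Bornology.IsBounded Ω)
    (hf : Continuous f) {M γ : ℝ} (hγ : 0 ≤ γ)
    (hmin : -sInf (primitive f '' Set.Icc 0 γ) ≤ M * primitive f γ) {φ : Rn N → ℝ}
    (hφ : IsTestFunction Ω φ) (hφ1 : ∀ x, 0 ≤ φ x ∧ φ x ≤ 1) {K : Set (Rn N)}
    (hK : MeasurableSet K) (hKΩ : K ⊆ Ω) (hφK : ∀ x ∈ K, φ x = 1) :
    (volume.real K - M * volume.real (Ω \ K)) * primitive f γ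
      ≤ ∫ x in Ω, primitive f (γ * φ x) := by
  have hfin : volume Ω ≠ ⊤ := hb.measure_lt_top.ne
  have hlow : ∀ t ∈ Set.Icc 0 γ, -(M * primitive f γ) ≤ primitive f t := by
    intro t ht
    have hbdd : BddBelow (primitive f '' Set.Icc 0 γ) :=
      (isCompact_Icc.image (continuous_primitive hf)).bddBelow
    have := csInf_le hbdd ⟨t, ht, rfl⟩
    linarith
  have hcont : Continuous fun x => primitive f (γ * φ x) :=
    (continuous_primitive hf).comp (continuous_const.mul hφ.smooth.continuous)
  have hint : IntegrableOn (fun x => primitive f (γ * φ x)) Ω :=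
    (hcont.locallyIntegrable.integrableOn_isCompact hb.isCompact_closure).mono_set subset_closure
  have e : ∫ x in Ω, primitive f (γ * φ x)
      = (∫ x in K, primitive f (γ * φ x)) + ∫ x in Ω \ K, primitive f (γ * φ x) := by
    rw [← setIntegral_union Set.disjoint_sdiff_right (hΩ.diff hK) (hint.mono_set hKΩ)
      (hint.mono_set Set.sdiff_subset), Set.union_sdiff_cancel hKΩ]
  have e1 : ∫ x in K, primitive f (γ * φ x) = volume.real K * primitive f γ := by
    rw [setIntegral_congr_fun (g := fun _ => primitive f γ) hK fun x hx => by
      simp only [hφK x hx, mul_one], setIntegral_const, smul_eq_mul]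
  have e2 : volume.real (Ω \ K) * -(M * primitive f γ)
      ≤ ∫ x in Ω \ K, primitive f (γ * φ x) := by
    rw [← smul_eq_mul, ← setIntegral_const]
    refine setIntegral_mono_on (integrableOn_const
      ((measure_mono Set.sdiff_subset).trans_lt hfin.lt_top).ne) (hint.mono_set Set.sdiff_subset)
      (hΩ.diff hK) fun x _ => hlow _ ⟨mul_nonneg hγ (hφ1 x).1, ?_⟩
    exact mul_le_of_le_one_right hγ (hφ1 x).2
  rw [e, e1]
  linarith [show volume.real (Ω \ K) * -(M * primitive f γ)
    = -(M * volume.real (Ω \ K) * primitive f γ) by ring,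
    show (volume.real K - M * volume.real (Ω \ K)) * primitive f γ
    = volume.real K * primitive f γ - M * volume.real (Ω \ K) * primitive f γ by ring]

end Solutions

/-! ### Sequences of solutions -/

section Sequences

/-- A limit `L > 0` of `F(γ_n) / γ_n ^ p` is eventually exceeded by a margin above `c / (lam κ)`,
once `lam` is larger than a threshold that vanishes for `L = ∞`. -/
theorem exists_threshold {p c κ : ℝ} (hc : 0 ≤ c) (hκ : 0 < κ) {L : EReal} (hL : 0 < L)
    {γ Fγ : ℕ → ℝ} (hγ : ∀ n, 0 < γ n)
    (hF : Tendsto (fun n => ((Fγ n / γ n ^ p : ℝ) : EReal)) atTop (𝓝 L)) :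
    ∃ lamBar : ℝ, 0 ≤ lamBar ∧ (L = ⊤ → lamBar = 0) ∧ ∀ lam : ℝ, lamBar < lam →
      ∃ δ : ℝ, 0 < δ ∧ ∀ᶠ n in atTop, c * γ n ^ p + δ * γ n ^ p ≤ lam * (κ * Fγ n) := by
  have key : ∀ lam q : ℝ, 0 < lam → c < lam * κ * q → (q : EReal) < L →
      ∃ δ : ℝ, 0 < δ ∧ ∀ᶠ n in atTop, c * γ n ^ p + δ * γ n ^ p ≤ lam * (κ * Fγ n) := by
    intro lam q hlam hq hqL
    refine ⟨lam * κ * q - c, by linarith, ?_⟩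
    filter_upwards [hF.eventually (lt_mem_nhds hqL)] with n hn
    have hpos : 0 < γ n ^ p := Real.rpow_pos_of_pos (hγ n) p
    have h1 : q * γ n ^ p < Fγ n := (lt_div_iff₀ hpos).1 (EReal.coe_lt_coe_iff.1 hn)
    have h2 : lam * κ * (q * γ n ^ p) ≤ lam * κ * Fγ n :=
      mul_le_mul_of_nonneg_left h1.le (by positivity)
    linarith
  by_cases hLt : L = ⊤
  · refine ⟨0, le_rfl, fun _ => rfl, fun lam hlam => key lam (c / (lam * κ) + 1) hlam ?_ ?_⟩
    · have : 0 < lam * κ := by positivity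
      rw [mul_add, mul_div_cancel₀ _ this.ne']
      linarith
    · rw [hLt]
      exact EReal.coe_lt_top _
  · lift L to ℝ using ⟨hLt, (bot_le.trans_lt hL).ne'⟩
    have hL' : 0 < L := by exact_mod_cast hL
    refine ⟨c / (κ * L), by positivity, fun h => absurd h hLt, fun lam hlam => ?_⟩
    have hlam0 : 0 < lam := lt_of_le_of_lt (by positivity) hlam
    have h1 : c / (lam * κ) < L := by
      rw [div_lt_iff₀ (by positivity)] at hlam ⊢
      linarith
    obtain ⟨q, hq1, hq2⟩ := exists_between h1
    rw [div_lt_iff₀ (by positivity)] at hq1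
    exact key lam q hlam0 (by linarith) (by exact_mod_cast hq2)

variable {X : Type*} [MeasurableSpace X] {μ : Measure X} {f : ℝ → ℝ}

theorem not_ae_eq_zero_of_integral_primitive_pos {u : X → ℝ}
    (h : 0 < ∫ x, primitive f (u x) ∂μ) : ¬ ∀ᵐ x ∂μ, u x = 0 := by
  intro hu
  have : ∫ x, primitive f (u x) ∂μ = 0 := by
    refine integral_eq_zero_of_ae ?_
    filter_upwards [hu] with x hx
    simp [hx, primitive]
  linarith

theorem ofReal_lt_eLpNorm_top_of_integral_primitive_gt [IsFiniteMeasure μ] {u : X → ℝ}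
    (hu : ∀ᵐ x ∂μ, 0 ≤ u x) {k B : ℝ} (hk : 0 ≤ k)
    (hfB : ∀ t ∈ Set.Icc 0 k, ‖primitive f t‖ ≤ B)
    (h : B * μ.real Set.univ < ∫ x, primitive f (u x) ∂μ) :
    ENNReal.ofReal k < eLpNorm u ⊤ μ := by
  by_contra! hle
  have h1 : ∀ᵐ x ∂μ, ‖primitive f (u x)‖ ≤ B := by
    filter_upwards [hu, ae_le_eLpNormEssSup (f := u) (μ := μ)] with x h0 h2
    rw [← eLpNorm_exponent_top, ← ofReal_norm, Real.norm_of_nonneg h0] at h2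
    exact hfB _ ⟨h0, (ENNReal.ofReal_le_ofReal_iff hk).1 (h2.trans hle)⟩
  have h2 := norm_integral_le_of_norm_le_const h1
  exact absurd h (not_lt.2 ((le_abs_self _).trans h2))

end Sequences

end DirichletOsc

open DirichletOsc in
theorem theorem3p1
    (N : ℕ) (hN : 1 ≤ N)
    (Ω : Set (DirichletOsc.Rn N)) (hΩ_open : IsOpen Ω) (hΩ_conn : IsConnected Ω)
    (hΩ_bdd : Bornology.IsBounded Ω)
    (p : ℝ) (hp : 1 < p)
    (Φ : DirichletOsc.Rn N → DirichletOsc.Rn N → ℝ)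
    (a : DirichletOsc.Rn N → DirichletOsc.Rn N → DirichletOsc.Rn N)
    (ha : DirichletOsc.IsVariationalOperator Ω p Φ a)
    (f : ℝ → ℝ) (hf : Continuous f) (hf0 : 0 ≤ f 0)
    (ℓ : ℝ≥0∞) (hℓ : ℓ = 0 ∨ ℓ = ⊤)
    (α : ℕ → ℝ) (hα_pos : ∀ n, 0 < α n)
    (hα_lim : Tendsto (fun n => ENNReal.ofReal (α n)) atTop (𝓝 ℓ))
    (hα_zero : ∀ n, f (α n) = 0)
    (γ : ℕ → ℝ) (hγ_pos : ∀ n, 0 < γ n)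
    (hγ_lim : Tendsto (fun n => ENNReal.ofReal (γ n)) atTop (𝓝 ℓ))
    (L : EReal) (hL : 0 < L)
    (hFγ : Tendsto (fun n => ((DirichletOsc.primitive f (γ n) / γ n ^ p : ℝ) : EReal))
      atTop (𝓝 L))
    (M : ℝ) (hM : 0 ≤ M)
    (hmin : ∀ n, -sInf (DirichletOsc.primitive f '' Set.Icc 0 (γ n))
      ≤ M * DirichletOsc.primitive f (γ n)) :
    ∃ lamBar : ℝ, 0 ≤ lamBar ∧ (L = ⊤ → lamBar = 0) ∧
      ∀ lam : ℝ, lamBar < lam →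
        ∃ u : ℕ → DirichletOsc.Rn N → ℝ,
          (∀ n, DirichletOsc.IsWeakSolution Ω p a f lam (u n) ∧
            MemLp (u n) ⊤ (volume.restrict Ω) ∧
            (∀ᵐ x ∂(volume.restrict Ω), 0 ≤ u n x) ∧
            ¬ (∀ᵐ x ∂(volume.restrict Ω), u n x = 0)) ∧
          Tendsto (fun n => eLpNorm (u n) ⊤ (volume.restrict Ω)) atTop (𝓝 ℓ) := by
  have hfinite : IsFiniteMeasure (volume.restrict Ω) := ⟨by simpa using hΩ_bdd.measure_lt_top⟩
  obtain ⟨c, β, hc, hcβ, hgrowth⟩ := ha.growth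
  obtain ⟨φ, K, hφ, hφ1, hK, hKΩ, hφK, hκ⟩ :=
    exists_cutoff hΩ_open hΩ_conn.nonempty hΩ_bdd hM
  set κ : ℝ := volume.real K - M * volume.real (Ω \ K) with hκdef
  set A : ℝ := ∫ x in Ω, ‖gradient φ x‖ ^ p with hA
  have hA0 : 0 ≤ A := integral_nonneg fun x => by positivity
  have hβ : 0 < β := by linarith
  have hp0 : 0 < p := by linarith
  obtain ⟨lamBar, hlamBar, hlamTop, hthr⟩ := exists_threshold (c := β / p * A) (κ := κ)
    (by positivity) hκ hL hγ_pos hFγ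
  refine ⟨lamBar, hlamBar, hlamTop, fun lam hlam => ?_⟩
  have hlam0 : 0 < lam := lt_of_le_of_lt hlamBar hlam
  obtain ⟨δ, hδ, hev⟩ := hthr lam hlam
  choose w hwsol hwbd hwtop hwmin using fun n => ha.exists_isWeakSolution hΩ_bdd hp hc hcβ hgrowth
    hf hf0 (hα_pos n) (hα_zero n) hlam0
  have hw0 : ∀ n, ∀ᵐ x ∂(volume.restrict Ω), 0 ≤ w n x := fun n =>
    (hwbd n).mono fun x hx => hx.1
  -- comparison of the solution below `α n` with the test function `γ m * φ`
  have hcomp : ∀ n m, γ m ≤ α n →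
      β / p * A * γ m ^ p + δ * γ m ^ p ≤ lam * (κ * primitive f (γ m)) →
      δ * γ m ^ p ≤ lam * ∫ x in Ω, primitive f (w n x) := by
    intro n m hmn hm
    have h1 := hwmin n _ (hφ.const_mul (γ m)) fun x =>
      ⟨mul_nonneg (hγ_pos m).le (hφ1 x).1,
        (mul_le_of_le_one_right (hγ_pos m).le (hφ1 x).2).trans hmn⟩
    have h2 := le_integral_primitive_cutoff hΩ_open.measurableSet hΩ_bdd hf (hγ_pos m).le (hmin m)
      hφ hφ1 hK hKΩ hφK
    have h3 : ∫ x in Ω, ‖gradient (fun x => γ m * φ x) x‖ ^ p = γ m ^ p * A := by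
      rw [hA, ← integral_const_mul]
      refine integral_congr_ae (Eventually.of_forall fun x => ?_)
      simp only
      rw [hφ.gradient_const_mul, norm_smul, Real.norm_of_nonneg (hγ_pos m).le,
        Real.mul_rpow (hγ_pos m).le (norm_nonneg _)]
    rw [h3] at h1
    have h4 := mul_le_mul_of_nonneg_left h2 hlam0.le
    linarith
  have hδγ : ∀ m, 0 < δ * γ m ^ p := fun m => mul_pos hδ (Real.rpow_pos_of_pos (hγ_pos m) p)
  rcases hℓ with rfl | rfl
  · refine ⟨w, fun n => ⟨hwsol n, hwtop n, hw0 n, ?_⟩, ?_⟩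
    · obtain ⟨m, hm1, hm2⟩ := (hev.and (hγ_lim.eventually
        (gt_mem_nhds (ENNReal.ofReal_pos.2 (hα_pos n))))).exists
      have h1 := hcomp n m ((ENNReal.ofReal_lt_ofReal_iff (hα_pos n)).1 hm2).le hm1
      exact not_ae_eq_zero_of_integral_primitive_pos
        (pos_of_mul_pos_right ((hδγ m).trans_le h1) hlam0.le)
    · refine tendsto_of_tendsto_of_tendsto_of_le_of_le tendsto_const_nhds hα_lim
        (fun _ => bot_le) fun n => ?_
      simp only
      rw [eLpNorm_exponent_top]
      refine eLpNormEssSup_le_of_ae_bound ?_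
      filter_upwards [hwbd n] with x hx
      rw [Real.norm_of_nonneg hx.1]
      exact hx.2
  · have hlarge : ∀ k : ℕ, ∃ n, ENNReal.ofReal k < eLpNorm (w n) ⊤ (volume.restrict Ω) := by
      intro k
      obtain ⟨B, hB⟩ := (isCompact_Icc (a := (0 : ℝ)) (b := k)).exists_bound_of_continuousOn
        (continuous_primitive hf).continuousOn
      set Z : ℝ := lam * (B * (volume.restrict Ω).real Set.univ) with hZ
      obtain ⟨m, hm1, hm2⟩ := (hev.and (hγ_lim.eventually
        (lt_mem_nhds (ENNReal.ofReal_lt_top (r := max 1 (Z / δ)))))).exists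
      have hm3 := (ENNReal.ofReal_lt_ofReal_iff (hγ_pos m)).1 hm2
      obtain ⟨n, hn⟩ := (hα_lim.eventually
        (lt_mem_nhds (ENNReal.ofReal_lt_top (r := γ m)))).exists
      have h1 := hcomp n m ((ENNReal.ofReal_lt_ofReal_iff (hα_pos n)).1 hn).le hm1
      have h2 : Z < δ * γ m ^ p := by
        have h3 := Real.self_le_rpow_of_one_le ((le_max_left _ _).trans hm3.le) hp.le
        have h4 := (div_lt_iff₀ hδ).1 ((le_max_right _ _).trans_lt hm3)
        nlinarith
      refine ⟨n, ofReal_lt_eLpNorm_top_of_integral_primitive_gt (hw0 n) (Nat.cast_nonneg k) hB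
        (lt_of_mul_lt_mul_left (h2.trans_le h1) hlam0.le)⟩
    choose n hn using hlarge
    refine ⟨fun k => w (n k), fun k => ⟨hwsol _, hwtop _, hw0 _, fun h => ?_⟩, ?_⟩
    · have h1 : eLpNorm (w (n k)) ⊤ (volume.restrict Ω) = 0 :=
        (eLpNorm_congr_ae h).trans eLpNorm_zero
      exact not_lt_bot ((hn k).trans_eq h1)
    · have h1 : Tendsto (fun k : ℕ => ENNReal.ofReal k) atTop (𝓝 ⊤) :=
        ENNReal.tendsto_ofReal_atTop.comp tendsto_natCast_atTop_atTop
      exact tendsto_of_tendsto_of_tendsto_of_le_of_le h1 tendsto_const_nhds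
        (fun k => (hn k).le) fun _ => le_top
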